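/- **Conventions.** Let $\Sigma$ be a finite alphabet and $k\ge 1$. *Tree stack automata.* For a finite set $C$ and a symbol $@\notin C$, a tree stack over $C$ is a pair $(\xi,\rho)$, where $\xi$ is a partial function from $\mathbb N_+^*$ to $C\sqcup\{@\}$ with finite prefix-closed domain containing $\varepsilon$, such that $\xi(\nu)=@$ if and only if $\nu=\varepsilon$, and where the pointer $\rho$ lies in $\operatorname{dom}(\xi)$. The predicates on tree stacks are $\mathrm{true}$ and $\mathrm{eq}(c)$ (meaning $\xi(\rho)=c$) for $c\in C\sqcup\{@\}$. The instructions are the partial functions $\mathrm{id}$; $\mathrm{push}_n(c)$ (if $\rho n\notin\operatorname{dom}\xi$: add the vertex $\rho n$ with label $c$ and move the pointer to it); $\mathrm{up}_n$ (if $\rho n\in\operatorname{dom}\xi$: move to $\rho n$); $\mathrm{down}$ (if $\rho\ne\varepsilon$: move to the parent); and $\mathrm{set}(c)$ (if $\rho\neq\varepsilon$: relabel $\rho$ by $c$), for $n\in\mathbb N_+$ and $c\in C$. A tree stack automaton (TSA) $\mathcal A$ has a finite state set $Q$, a finite label set $C$, an initial state, a set of final states, and a finite set of rules $(q,x,p,f,q')$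 with $q,q'\in Q$, $x\in\Sigma\cup\{\varepsilon\}$, $p$ a predicate and $f$ an instruction. A run is a sequence $\tau_1\cdots\tau_r$ of rules that can be applied in succession, starting from the initial state and the one-vertex tree stack. It is valid if it ends in a final state, and it then accepts the word that it reads; $L(\mathcal A)$ is the set of accepted words. A run is $k$-restricted if each non-root vertex $\nu n$ is entered from its parent $\nu$ (by $\mathrm{push}_n(c)$ or $\mathrm{up}_n$) at most $k$ times. $\mathcal A$ is $k$-restricted if every $w\in L(\mathcal A)$ is accepted by some $k$-restricted run. A language is $k$-multiple context-free ($k$-MCF) if it equals $L(\mathcal A)$ for some $k$-restricted TSA $\mathcal A$. *Standard acceptors.* Call a rule idle if it reads $\varepsilon$ and its instruction is $\mathrm{id}$ or some $\mathrm{set}(c)$. $\mathcal A$ is standardised if whenever two idle rules, from $q_1$ to $q_2$ and from $q_2$ to $q_3$, can be applied one after the other to some tree stack, there is an idle rule from $q_1$ to $q_3$ whose effect on tree stacks (as a partial function) is that of applying the two in succession. A standard acceptor for $L$ is a standardised $k$-restricted TSA $\mathcal A$ with $L(\mathcal A)=L$, all of whose valid runs end with the pointer at the root, and which has at least one rule with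 a push instruction. A run is proper if it is valid and has no two consecutive idle rules. *Level-1 up-sets.* In a valid run $\tau_1\cdots\tau_r$ of a standard acceptor, list in order all excursions of the pointer away from the root: for $1\le i\le s$ the rule $\tau_{l_i}$ moves the pointer from the root to its child $n_i$, the pointer is not at the root after each of $\tau_{l_i},\dots,\tau_{m_i}$, and $\tau_{m_i+1}$ returns it to the root. Let $u_i$ be the word read by $\tau_{l_i+1}\cdots\tau_{m_i}$. The level-1 history array of the run records, for each $i$, the child $n_i$ together with the label of the vertex $n_i$ and the state of $\mathcal A$, both immediately after $\tau_{l_i}$ and immediately after $\tau_{m_i}$. The level-1 up-set of $\mathcal A$ associated to an array $h$ with $s$ excursions is the set of all $(u_1,\dots,u_s)\in(\Sigma^*)^s$ obtained from proper runs with level-1 history array $h$. *Factorisations.* For $U\subseteq(\Sigma^*)^s$, a $U$-switchable factorisation of $w\in L$ is a factorisation $w=w_0u_1w_1\cdots u_sw_s$ with $(u_1,\dots,u_s)\in U$ such that $w_0v_1w_1\cdots v_sw_s\in L$ for all $(v_1,\dots,v_s)\in U$. A word $w\in L$ is $(a,b)$-pumpable if $w=xyz$ with $a\le|y|\le b$ and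 $xy^nz\in L$ for all $n\ge0$. If some letters of a word are marked, then $|\cdot|_\#$ denotes the number of marked letters. **Proposition (Bounded Substitution Lemma).** Let $L$ be an infinite $k$-MCF language over $\Sigma$. Then $L$ has a standard acceptor. Moreover, let $\mathcal A$ be any standard acceptor for $L$. Given $\mu\in\mathbb N_+$, there exist integers $K,M,m_1,\dots,m_M\in\mathbb N_+$ with $K\ge k$ and $m_i\in[1,K]$, and sets $U_1,\dots,U_M$ with $U_i\subseteq(\Sigma^*)^{m_i}$, each $U_i$ being a level-1 up-set of $\mathcal A$, such that the following hold. 1. For each $i\in[1,M]$ and each $(u_1,\dots,u_{m_i})\in U_i$ there exists a word $w\in L$ with a $U_i$-switchable factorisation $w=w_0u_1w_1\cdots u_{m_i}w_{m_i}$. 2. There exists $N_\mu\in\mathbb N_+$ with $N_\mu\ge\mu$ such that if $w\in L$ and at least $N_\mu$ letters of $w$ are marked, then either (a) $w$ is $(\mu,N_\mu)$-pumpable, or (b) there exists $i\in[1,M]$ such that $U_i$ is infinite and $w$ has a $U_i$-switchable factorisation $w=w_0u_1w_1\cdots u_{m_i}w_{m_i}$ satisfying $\sum_{j=0}^{m_i}|w_j|_\#\le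 N_\mu$. -/

import Mathlib

/-! ### Words, factorisations, marked words -/

/-- The word `w₀ u₁ w₁ u₂ w₂ ⋯ uₛ wₛ`. -/
def interleave {α : Type*} {s : ℕ} (w : Fin (s + 1) → List α) (u : Fin s → List α) : List α :=
  w 0 ++ (List.ofFn fun j : Fin s => u j ++ w j.succ).flatten

/-- `x = w₀ u₁ w₁ ⋯ uₛ wₛ` is a `U`-switchable factorisation of the word `x ∈ L`. -/
structure IsSwitchableFactorisation {α : Type*} {s : ℕ} (L : Language α)
    (U : Set (Fin s → List α)) (x : List α)
    (w : Fin (s + 1) → List α) (u : Fin s → List α) : Prop where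
  mem : x ∈ L
  eq : x = interleave w u
  factor_mem : u ∈ U
  switch : ∀ v ∈ U, interleave w v ∈ L

/-- The word `w ∈ L` is `(a, b)`-pumpable. -/
def IsPumpable {α : Type*} (L : Language α) (a b : ℕ) (w : List α) : Prop :=
  w ∈ L ∧ ∃ x y z : List α, w = x ++ y ++ z ∧ a ≤ y.length ∧ y.length ≤ b ∧
    ∀ n : ℕ, x ++ (List.replicate n y).flatten ++ z ∈ L

/-- A word some of whose letters are marked: a letter is marked if its second component is
`true`. -/
abbrev MarkedWord (α : Type*) := List (α × Bool)

/-- The word that remains when the marking is forgotten. -/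
def MarkedWord.forget {α : Type*} (w : MarkedWord α) : List α := w.map Prod.fst

/-- The number of marked letters. -/
def MarkedWord.numMarked {α : Type*} (w : MarkedWord α) : ℕ := w.countP Prod.snd

/-! ### Tree stacks -/

/-- The address `n₁ n₂ ⋯ n_d` of a vertex is stored with its last entry first, as the list
`[n_d, …, n₂, n₁]`. So the root is `[]`, and the `n`-th child of `ν` is `n :: ν`. -/
abbrev Address := List ℕ+

/-- Trees with labels in `C`: partial functions from addresses to `C ⊔ {@}` with a finite
prefix-closed domain that contains the root, where exactly the root has the label `@`.
`label ν = none` says that `ν` is not in the domain, `label ν = some none` that `ν` has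
the label `@`, and `label ν = some (some c)` that `ν` has the label `c`. -/
@[ext]
structure LabelledTree (C : Type*) where
  label : Address → Option (Option C)
  finite_domain : {ν | label ν ≠ none}.Finite
  parent_mem : ∀ (ν : Address) (n : ℕ+), label (n :: ν) ≠ none → label ν ≠ none
  label_eq_at_iff : ∀ ν : Address, label ν = some none ↔ ν = []

/-- A tree stack over `C`: a tree with labels in `C` and a pointer to one of its vertices. -/
@[ext]
structure TreeStack (C : Type*) where
  tree : LabelledTree C
  pointer : Address
  pointer_mem : tree.label pointer ≠ none

/-- The predicates `true` and `eq(c)` for `c ∈ C ⊔ {@}`; here `none` stands for `@`. -/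
inductive StackPred (C : Type*) where
  | tt : StackPred C
  | eq (c : Option C) : StackPred C

/-- The predicate is true for the tree stack `t`. -/
def StackPred.Holds {C : Type*} : StackPred C → TreeStack C → Prop
  | .tt, _ => True
  | .eq c, t => t.tree.label t.pointer = some c

/-- The instructions `id`, `push_n(c)`, `up_n`, `down` and `set(c)`. -/
inductive Instr (C : Type*) where
  | id : Instr C
  | push (n : ℕ+) (c : C) : Instr C
  | up (n : ℕ+) : Instr C
  | down : Instr C
  | set (c : C) : Instr C

/-- `f.Maps t t'`: the partial function `f` is defined at the tree stack `t`, with value `t'`. -/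
def Instr.Maps {C : Type*} : Instr C → TreeStack C → TreeStack C → Prop
  | .id, t, t' => t' = t
  | .push n c, t, t' =>
      t.tree.label (n :: t.pointer) = none ∧
      t'.tree.label = Function.update t.tree.label (n :: t.pointer) (some (some c)) ∧
      t'.pointer = n :: t.pointer
  | .up n, t, t' =>
      t.tree.label (n :: t.pointer) ≠ none ∧ t'.tree = t.tree ∧ t'.pointer = n :: t.pointer
  | .down, t, t' => t'.tree = t.tree ∧ ∃ n : ℕ+, t.pointer = n :: t'.pointer
  | .set c, t, t' =>
      t.pointer ≠ [] ∧
      t'.tree.label = Function.update t.tree.label t.pointer (some (some c)) ∧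
      t'.pointer = t.pointer

/-- The instructions `id` and `set(c)`, which do not move the pointer. -/
def Instr.IsStationary {C : Type*} (f : Instr C) : Prop :=
  f = .id ∨ ∃ c : C, f = .set c

/-- The initial tree stack: only a root, and the pointer at it. -/
def TreeStack.initial (C : Type*) : TreeStack C where
  tree :=
    { label := fun ν => if ν = [] then some none else none
      finite_domain := (Set.finite_singleton ([] : Address)).subset (by
        intro ν hν
        by_contra h
        exact hν (if_neg h))
      parent_mem := by intro ν n h; simp at h
      label_eq_at_iff := by intro ν; by_cases h : ν = [] <;> simp [h] }
  pointer := []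
  pointer_mem := by simp

/-! ### Tree stack automata -/

/-- A transition rule `(q, x, p, f, q')`; the letter `none` stands for the empty word. -/
structure Transition (Q C α : Type*) where
  source : Q
  letter : Option α
  pred : StackPred C
  instr : Instr C
  target : Q

/-- The effect of a transition rule on the tree stack, as a partial function. -/
def Transition.Maps {Q C α : Type*} (τ : Transition Q C α) (t t' : TreeStack C) : Prop :=
  τ.pred.Holds t ∧ τ.instr.Maps t t'

/-- The rule reads the empty word and does not move the pointer. -/
def Transition.IsIdle {Q C α : Type*} (τ : Transition Q C α) : Prop :=
  τ.letter = none ∧ τ.instr.IsStationary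

/-- A tree stack automaton with states `Q`, tree labels `C` and terminals `α`. These three are
required to be finite wherever automata are used below. -/
structure TSA (Q C α : Type*) where
  initial : Q
  rules : Set (Transition Q C α)
  finite_rules : rules.Finite
  final : Set Q

namespace TSA

variable {Q C α : Type*}

/-- A run `τ₁ ⋯ τ_r` of the automaton, together with the states and tree stacks it passes
through. Here `r = len`, `rule i` is `τ_{i+1}` for `i < len`, and `state i`, `stack i` are the
state and the tree stack after `τ₁ ⋯ τ_i` for `i ≤ len`; other values are irrelevant. -/
structure Run (A : TSA Q C α) where
  len : ℕ
  rule : ℕ → Transition Q C α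
  state : ℕ → Q
  stack : ℕ → TreeStack C
  state_zero : state 0 = A.initial
  stack_zero : stack 0 = TreeStack.initial C
  rule_mem : ∀ i < len, rule i ∈ A.rules
  source_eq : ∀ i < len, (rule i).source = state i
  target_eq : ∀ i < len, (rule i).target = state (i + 1)
  maps : ∀ i < len, (rule i).Maps (stack i) (stack (i + 1))

namespace Run

variable {A : TSA Q C α}

/-- The position of the pointer after `τ₁ ⋯ τ_i`. -/
def ptr (R : A.Run) (i : ℕ) : Address := (R.stack i).pointer

/-- The factor of the input that is read by `τ_{i+1} ⋯ τ_j`. -/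
def read (R : A.Run) (i j : ℕ) : List α :=
  (List.Ico i j).flatMap fun x => (R.rule x).letter.toList

/-- The run is valid and consumes the input word `w`. -/
def Accepts (R : A.Run) (w : List α) : Prop :=
  R.state R.len ∈ A.final ∧ R.read 0 R.len = w

/-- No two consecutive transitions read the empty word without moving the pointer. (Together
with validity, this says that the run is proper.) -/
def IsProper (R : A.Run) : Prop :=
  ∀ i, i + 1 < R.len → ¬ ((R.rule i).IsIdle ∧ (R.rule (i + 1)).IsIdle)

/-- The vertex `n :: ν` is visited from below by `τ_{i+1}`. -/
def VisitsFromBelow (R : A.Run) (ν : Address) (n : ℕ+) (i : ℕ) : Prop :=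
  i < R.len ∧ R.ptr i = ν ∧
    ((∃ c : C, (R.rule i).instr = .push n c) ∨ (R.rule i).instr = .up n)

/-- Every non-root vertex is visited from below at most `k` times. -/
def IsRestricted (R : A.Run) (k : ℕ) : Prop :=
  ∀ (ν : Address) (n : ℕ+), {i | R.VisitsFromBelow ν n i}.ncard ≤ k

/-- The level-1-up-down array of the run, with rows `l`, `m`, `n`. Its columns correspond to
the excursions of the pointer away from the root, in order: the `i`-th one starts with `τ_{l i}`,
which moves the pointer from the root to its child `n i`; the pointer is not at the root
after `τ_j` for `l i ≤ j ≤ m i`; and `τ_{m i + 1}` moves it back to the root. -/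
structure IsLevelOneArray (R : A.Run) {s : ℕ} (l m : Fin s → ℕ) (n : Fin s → ℕ+) : Prop where
  strictMono : StrictMono l
  le : ∀ i, l i ≤ m i
  pos : ∀ i, 0 < l i
  lt_len : ∀ i, m i < R.len
  ptr_before : ∀ i, R.ptr (l i - 1) = []
  ptr_start : ∀ i, R.ptr (l i) = [n i]
  ptr_between : ∀ i j, l i ≤ j → j ≤ m i → R.ptr j ≠ []
  ptr_after : ∀ i, R.ptr (m i + 1) = []
  complete : ∀ j < R.len, R.ptr j = [] → R.ptr (j + 1) ≠ [] → ∃ i, l i = j + 1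

end Run

/-- The language of the automaton. -/
def language (A : TSA Q C α) : Language α := {w | ∃ R : A.Run, R.Accepts w}

/-- The automaton is `k`-restricted: each accepted word has a `k`-restricted accepting run. -/
def IsRestricted (A : TSA Q C α) (k : ℕ) : Prop :=
  ∀ w ∈ A.language, ∃ R : A.Run, R.Accepts w ∧ R.IsRestricted k

/-- The automaton is standardised: if two rules which read the empty word and do not move the
pointer can be applied one after the other, then there is a single rule of this kind which
achieves the same outcome. -/
def IsStandardised (A : TSA Q C α) : Prop :=
  ∀ τ₁ ∈ A.rules, ∀ τ₂ ∈ A.rules, τ₁.IsIdle → τ₂.IsIdle → τ₁.target = τ₂.source →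
    (∃ t t' t'' : TreeStack C, τ₁.Maps t t' ∧ τ₂.Maps t' t'') →
    ∃ τ₃ ∈ A.rules, τ₃.IsIdle ∧ τ₃.source = τ₁.source ∧ τ₃.target = τ₂.target ∧
      ∀ t t'' : TreeStack C, τ₃.Maps t t'' ↔ ∃ t', τ₁.Maps t t' ∧ τ₂.Maps t' t''

/-- Every valid run ends with the pointer at the root. -/
def ReturnsToRoot (A : TSA Q C α) : Prop :=
  ∀ R : A.Run, R.state R.len ∈ A.final → R.ptr R.len = []

/-- Some rule has a push instruction; in other words, the automaton has positive degree. -/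
def HasPush (A : TSA Q C α) : Prop :=
  ∃ τ ∈ A.rules, ∃ (n : ℕ+) (c : C), τ.instr = .push n c

/-- `A` is a standardised `k`-restricted automaton which accepts `L`, subject to the usual
conventions that the pointer returns to the root and that there is a push command. -/
structure IsStandardAcceptor (A : TSA Q C α) (k : ℕ) (L : Language α) : Prop where
  language_eq : A.language = L
  restricted : A.IsRestricted k
  standardised : A.IsStandardised
  returnsToRoot : A.ReturnsToRoot
  hasPush : A.HasPush

/-- The entries of a level-1-history array. For the `i`-th excursion from the root, these are the
tree label of the child `child i` and the state, just after the pointer has moved up to that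
child (`cUp`, `qUp`) and just before it moves down to the root (`cDown`, `qDown`). -/
structure LevelOneHistory (Q C : Type*) (s : ℕ) where
  cUp : Fin s → C
  cDown : Fin s → C
  qUp : Fin s → Q
  qDown : Fin s → Q
  child : Fin s → ℕ+

/-- `h` is the level-1-history array of the run `R`, whose level-1-up-down array has the first
two rows `l` and `m`. -/
structure Run.HasLevelOneHistory {A : TSA Q C α} (R : A.Run) {s : ℕ} (l m : Fin s → ℕ)
    (h : LevelOneHistory Q C s) : Prop where
  isArray : R.IsLevelOneArray l m h.child
  label_up : ∀ i, (R.stack (l i)).tree.label [h.child i] = some (some (h.cUp i))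
  label_down : ∀ i, (R.stack (m i)).tree.label [h.child i] = some (some (h.cDown i))
  state_up : ∀ i, R.state (l i) = h.qUp i
  state_down : ∀ i, R.state (m i) = h.qDown i

/-- The level-1-up-set associated to `h`: the tuples `(u₁, …, uₛ)` for which some proper
accepting run with level-1-history array `h` reads `uᵢ` by the transitions
`τ_{l i + 1} ⋯ τ_{m i}` of its `i`-th excursion from the root. -/
def levelOneUpSet (A : TSA Q C α) {s : ℕ} (h : LevelOneHistory Q C s) :
    Set (Fin s → List α) :=
  {u | ∃ R : A.Run, R.state R.len ∈ A.final ∧ R.IsProper ∧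
    ∃ l m : Fin s → ℕ, R.HasLevelOneHistory l m h ∧ ∀ i, u i = R.read (l i) (m i)}

end TSA

/-- `L` is a `k`-multiple context-free language: it is the language of a `k`-restricted tree
stack automaton. -/
def IsMCF {α : Type*} (k : ℕ) (L : Language α) : Prop :=
  ∃ (Q C : Type) (_ : Finite Q) (_ : Finite C) (A : TSA Q C α),
    A.language = L ∧ A.IsRestricted k

/-! Everything happens at the root. There `set` and `down` are undefined and the label is always
`@`. So while the pointer stays at the root, only `id` is executed, the tree stack is frozen, and
each rule used can be applied to every tree stack whose pointer is at the root.

Switchability. Let two valid runs `R`, `R'` have the same level-1 history. The root phases of `R`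
can be spliced with the excursions of `R'`, keeping the tree stack of `R'` throughout. The states
fit by the history. The sequence of children tells which children of the root exist, hence whether
an excursion opens with a push or an up; the recorded labels fix what is pushed and what the
predicate of the closing `down` sees. This is `Run.HasLevelOneHistory.reaches_interleave`. So each
proper run yields a factorisation that is switchable for its up-set.

Boundedness. A root phase that reads at least `μ * |Q|` letters repeats a state with the same tree
stack, at least `μ` letters apart, and the word is pumpable (`Run.isPumpable_of_root`). Otherwise
each outer factor has at most `μ * |Q| + 2` letters. Finitely many children occur in the rules and a
`k`-restricted run enters each at most `k` times, so the number of excursions is bounded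
(`Run.IsLevelOneArray.card_le`) and finitely many histories matter. The finite ones among their
up-sets have tuples of total length at most some `B`; a word with enough marked letters is longer
than all of this allows, so its up-set is infinite.

Existence of a standard acceptor: add states that walk back to the root, then close the idle rules
under composition. There are only finitely many idle rules over finite `Q` and `C`. -/

namespace TSA

variable {Q C α : Type*}

/-! ### Extending runs, and reachable configurations -/

namespace Run

variable {A : TSA Q C α}

theorem read_self (R : A.Run) (i : ℕ) : R.read i i = [] := by simp [read]

theorem read_succ (R : A.Run) {i j : ℕ} (h : i ≤ j) :
    R.read i (j + 1) = R.read i j ++ (R.rule j).letter.toList := by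
  simp [read, List.Ico.succ_top h]

theorem read_append (R : A.Run) {i j k : ℕ} (hij : i ≤ j) (hjk : j ≤ k) :
    R.read i j ++ R.read j k = R.read i k := by
  simp [read, ← List.Ico.append_consecutive hij hjk]

theorem read_congr (R : A.Run) {Q' C' : Type*} {A' : TSA Q' C' α} (R' : A'.Run) {i j : ℕ}
    (h : ∀ x, i ≤ x → x < j → (R.rule x).letter = (R'.rule x).letter) :
    R.read i j = R'.read i j := by
  unfold read
  refine List.flatMap_congr fun x hx => ?_
  rw [List.Ico.mem] at hx
  rw [h x hx.1 hx.2]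

theorem finite_visits (R : A.Run) (ν : Address) (n : ℕ+) :
    {i | R.VisitsFromBelow ν n i}.Finite :=
  (Set.finite_lt_nat R.len).subset fun _ hi => hi.1

/-- The run with no transitions. -/
def nil (A : TSA Q C α) (τ : Transition Q C α) : A.Run where
  len := 0
  rule _ := τ
  state _ := A.initial
  stack _ := TreeStack.initial C
  state_zero := rfl
  stack_zero := rfl
  rule_mem := by simp
  source_eq := by simp
  target_eq := by simp
  maps := by simp

/-- The run `R` followed by one more transition. -/
def snoc (R : A.Run) (τ : Transition Q C α) (t : TreeStack C) (hτ : τ ∈ A.rules)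
    (hs : τ.source = R.state R.len) (hm : τ.Maps (R.stack R.len) t) : A.Run where
  len := R.len + 1
  rule i := if i = R.len then τ else R.rule i
  state i := if i = R.len + 1 then τ.target else R.state i
  stack i := if i = R.len + 1 then t else R.stack i
  state_zero := by simp [R.state_zero]
  stack_zero := by simp [R.stack_zero]
  rule_mem i hi := by
    split_ifs with h
    · exact hτ
    · exact R.rule_mem i (by omega)
  source_eq i hi := by
    rw [if_neg (by omega : ¬ i = R.len + 1)]
    split_ifs with h
    · rw [hs, h]
    · exact R.source_eq i (by omega)
  target_eq i hi := by
    by_cases h : i = R.len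
    · simp [h]
    · simpa [h] using R.target_eq i (by omega)
  maps i hi := by
    rw [if_neg (by omega : ¬ i = R.len + 1)]
    by_cases h : i = R.len
    · simpa [h] using hm
    · simpa [h] using R.maps i (by omega)

section snoc

variable (R : A.Run) (τ : Transition Q C α) (t : TreeStack C) (hτ : τ ∈ A.rules)
  (hs : τ.source = R.state R.len) (hm : τ.Maps (R.stack R.len) t)

theorem read_snoc : (R.snoc τ t hτ hs hm).read 0 (R.len + 1) =
    R.read 0 R.len ++ τ.letter.toList := by
  rw [read_succ _ (Nat.zero_le _)]
  congr 1
  · refine read_congr _ _ fun x _ hx => ?_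
    simp [snoc, hx.ne]
  · simp [snoc]

theorem isRestricted_snoc {k : ℕ} (hR : R.IsRestricted k)
    (hpush : ∀ n c, τ.instr ≠ .push n c) (hup : ∀ n, τ.instr ≠ .up n) :
    (R.snoc τ t hτ hs hm).IsRestricted k := by
  intro ν n
  refine (Set.ncard_le_ncard ?_ (R.finite_visits ν n)).trans (hR ν n)
  rintro i ⟨hi, hp, hv⟩
  have hi' : i < R.len + 1 := hi
  by_cases h : i = R.len
  · simp [snoc, h, hpush, hup] at hv
  · refine ⟨by omega, ?_, ?_⟩
    · simpa [snoc, ptr, hi'.ne] using hp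
    · simpa [snoc, h] using hv

end snoc

end Run

/-- Some run leads to the state `q` and the tree stack `t` and reads `w`. -/
def Reaches (A : TSA Q C α) (q : Q) (t : TreeStack C) (w : List α) : Prop :=
  ∃ R : A.Run, R.state R.len = q ∧ R.stack R.len = t ∧ R.read 0 R.len = w

/-- Some `k`-restricted run leads to the state `q` and the tree stack `t` and reads `w`. -/
def ReachesWithin (A : TSA Q C α) (k : ℕ) (q : Q) (t : TreeStack C) (w : List α) : Prop :=
  ∃ R : A.Run, R.state R.len = q ∧ R.stack R.len = t ∧ R.read 0 R.len = w ∧ R.IsRestricted k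

variable {A : TSA Q C α}

theorem mem_language_iff {w : List α} :
    w ∈ A.language ↔ ∃ q ∈ A.final, ∃ t, A.Reaches q t w := by
  constructor
  · rintro ⟨R, h, hw⟩
    exact ⟨_, h, _, R, rfl, rfl, hw⟩
  · rintro ⟨q, hq, t, R, rfl, -, hw⟩
    exact ⟨R, hq, hw⟩

/-- The rule `τ` only fills the irrelevant values of the total function `rule`. -/
theorem Reaches.nil (τ : Transition Q C α) : A.Reaches A.initial (TreeStack.initial C) [] :=
  ⟨Run.nil A τ, rfl, rfl, Run.read_self _ _⟩

theorem Reaches.step {q q' : Q} {t t' : TreeStack C} {w : List α} (h : A.Reaches q t w)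
    {τ : Transition Q C α} (hτ : τ ∈ A.rules) (hs : τ.source = q) (ht : τ.target = q')
    (hm : τ.Maps t t') : A.Reaches q' t' (w ++ τ.letter.toList) := by
  obtain ⟨R, rfl, rfl, rfl⟩ := h
  exact ⟨R.snoc τ t' hτ hs hm, by simp [Run.snoc, ht], by simp [Run.snoc], R.read_snoc ..⟩

/-- Rules that do not enter a vertex from below preserve `k`-restrictedness for free. This is enough
for the walk back to the root. -/
theorem ReachesWithin.step {k : ℕ} {q q' : Q} {t t' : TreeStack C} {w : List α}
    (h : A.ReachesWithin k q t w) {τ : Transition Q C α} (hτ : τ ∈ A.rules) (hs : τ.source = q)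
    (ht : τ.target = q') (hm : τ.Maps t t') (hl : τ.letter = none)
    (hpush : ∀ n c, τ.instr ≠ .push n c) (hup : ∀ n, τ.instr ≠ .up n) :
    A.ReachesWithin k q' t' w := by
  obtain ⟨R, rfl, rfl, rfl, hR⟩ := h
  refine ⟨R.snoc τ t' hτ hs hm, by simp [Run.snoc, ht], by simp [Run.snoc], ?_,
    R.isRestricted_snoc τ t' hτ hs hm hR hpush hup⟩
  exact (R.read_snoc ..).trans (by simp [hl])

theorem Run.induction_on_prefix (R : A.Run) {P : ℕ → Prop} {a b : ℕ} (hb : b ≤ R.len)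
    (h0 : P a) (hs : ∀ j, a ≤ j → j < b → j < R.len → P j → P (j + 1)) :
    ∀ j, a ≤ j → j ≤ b → P j := by
  intro j hj
  induction j, hj using Nat.le_induction with
  | base => exact fun _ => h0
  | succ j hj ih => exact fun hjb => hs j hj (by omega) (by omega) (ih (by omega))

/-- The word `w` need not be the one `R` has read up to time `i`: only the configuration matters.
Pumping and splicing both rely on this. -/
theorem Reaches.along (R : A.Run) {i j : ℕ} {w : List α}
    (h : A.Reaches (R.state i) (R.stack i) w) (hij : i ≤ j) (hj : j ≤ R.len) :
    A.Reaches (R.state j) (R.stack j) (w ++ R.read i j) := by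
  refine R.induction_on_prefix (P := fun j => A.Reaches (R.state j) (R.stack j) (w ++ R.read i j))
    hj (by simpa [Run.read_self] using h) (fun j hij _ hj ih => ?_) j hij le_rfl
  rw [Run.read_succ _ hij, ← List.append_assoc]
  exact ih.step (R.rule_mem j hj) (R.source_eq j hj) (R.target_eq j hj) (R.maps j hj)

theorem Run.reaches (R : A.Run) {j : ℕ} (hj : j ≤ R.len) :
    A.Reaches (R.state j) (R.stack j) (R.read 0 j) := by
  have h : A.Reaches (R.state 0) (R.stack 0) [] := by
    rw [R.state_zero, R.stack_zero]
    exact .nil (R.rule 0)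
  simpa using h.along R (Nat.zero_le _) hj

end TSA

/-! ### Auxiliary tree stacks -/

/-- Without other labels each vertex carries `@`, and only the root may do so. -/
theorem TreeStack.eq_initial {C : Type*} [IsEmpty C] (t : TreeStack C) :
    t = TreeStack.initial C := by
  have key : ∀ ν, t.tree.label ν ≠ none ↔ ν = [] := fun ν => by
    rw [← t.tree.label_eq_at_iff ν]
    cases h : t.tree.label ν with
    | none => simp
    | some c => cases c with
      | none => simp
      | some c => exact isEmptyElim c
  refine TreeStack.ext (LabelledTree.ext (funext fun ν => ?_)) ((key _).1 t.pointer_mem)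
  by_cases h : ν = []
  · simpa [TreeStack.initial, h] using (t.tree.label_eq_at_iff []).2 rfl
  · simpa [TreeStack.initial, h] using (key ν).not.2 h

/-- The tree stack with the pointer moved to the parent. -/
def TreeStack.parent {C : Type*} (t : TreeStack C) (ν : Address) (n : ℕ+)
    (h : t.pointer = n :: ν) : TreeStack C where
  tree := t.tree
  pointer := ν
  pointer_mem := t.tree.parent_mem ν n (h ▸ t.pointer_mem)

/-- The tree stack with a new label at the pointer. -/
def TreeStack.relabel {C : Type*} (t : TreeStack C) (h : t.pointer ≠ []) (c : C) :
    TreeStack C where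
  tree :=
    { label := Function.update t.tree.label t.pointer (some (some c))
      finite_domain := (t.tree.finite_domain.insert t.pointer).subset fun ν hν => by
        by_cases h : ν = t.pointer
        · exact Or.inl h
        · exact Or.inr (by simpa [Function.update_of_ne h] using hν)
      parent_mem := fun ν n hν => by
        by_cases h' : ν = t.pointer
        · simp [h']
        · rw [Function.update_of_ne h']
          by_cases h'' : n :: ν = t.pointer
          · exact t.tree.parent_mem ν n (h'' ▸ t.pointer_mem)
          · exact t.tree.parent_mem ν n (by rwa [Function.update_of_ne h''] at hν)
      label_eq_at_iff := fun ν => by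
        by_cases h' : ν = t.pointer
        · simp [h', h]
        · rw [Function.update_of_ne h', t.tree.label_eq_at_iff] }
  pointer := t.pointer
  pointer_mem := by simp

namespace TSA

variable {Q C α : Type*}

/-! ### Automata with no tree labels -/

/-- For an automaton with no tree labels, an equivalent one with a single label. -/
def withUnitLabel (A : TSA Q C α) : TSA Q Unit α where
  initial := A.initial
  rules := (fun τ : Transition Q C α => ⟨τ.source, τ.letter, .tt, .id, τ.target⟩) ''
    {τ ∈ A.rules | τ.Maps (TreeStack.initial C) (TreeStack.initial C)}
  finite_rules := (A.finite_rules.subset fun _ h => h.1).image _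
  final := A.final

theorem isRestricted_withUnitLabel (A : TSA Q C α) (k : ℕ) :
    A.withUnitLabel.IsRestricted k := by
  rintro w ⟨R, hR⟩
  refine ⟨R, hR, fun ν n => ?_⟩
  have : {i | R.VisitsFromBelow ν n i} = ∅ := by
    refine Set.eq_empty_of_forall_notMem ?_
    rintro i ⟨hi, -, hv⟩
    obtain ⟨τ, -, h⟩ := R.rule_mem i hi
    rw [← h] at hv
    simp at hv
  simp [this]

/-- There is only one tree stack, so a rule is applicable either always or never, and exactly the
former rules are kept. -/
theorem language_withUnitLabel [IsEmpty C] (A : TSA Q C α) :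
    A.withUnitLabel.language = A.language := by
  have hst : ∀ t : TreeStack C, t = TreeStack.initial C := TreeStack.eq_initial
  apply Set.Subset.antisymm
  · rintro w ⟨R, hR, rfl⟩
    have key := R.induction_on_prefix
      (P := fun j => A.Reaches (R.state j) (TreeStack.initial C) (R.read 0 j)) (a := 0) le_rfl ?_ ?_
    · exact mem_language_iff.2 ⟨_, hR, _, key _ (Nat.zero_le _) le_rfl⟩
    · rw [R.state_zero, R.read_self]
      let τ := R.rule 0
      exact .nil ⟨τ.source, τ.letter, .tt, .id, τ.target⟩
    · intro j _ _ hj ih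
      rw [R.read_succ (Nat.zero_le _)]
      obtain ⟨τ, ⟨hτ, hm⟩, h⟩ := R.rule_mem j hj
      rw [← h]
      exact ih.step hτ (by simpa [← h] using R.source_eq j hj)
        (by simpa [← h] using R.target_eq j hj) hm
  · rintro w ⟨R, hR, hw⟩
    refine ⟨⟨R.len, fun i => ⟨(R.rule i).source, (R.rule i).letter, .tt, .id, (R.rule i).target⟩,
      R.state, fun _ => TreeStack.initial Unit, R.state_zero, rfl, fun i hi => ⟨R.rule i,
        ⟨R.rule_mem i hi, ?_⟩, rfl⟩, R.source_eq, R.target_eq, fun i hi => ⟨trivial, rfl⟩⟩, hR, hw⟩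
    have := R.maps i hi
    rwa [hst (R.stack i), hst (R.stack (i + 1))] at this

/-! ### Automata that return to the root -/

/-- The automaton with states relabelled, and with additional states which move the pointer
to the root after a final state of `A` has been reached, and which may then visit its first
child once if it is new. -/
def returning [Finite Q] (A : TSA Q C α) (c : C) : TSA (Q ⊕ Bool) C α where
  initial := .inl A.initial
  rules :=
    (fun τ : Transition Q C α => ⟨.inl τ.source, τ.letter, τ.pred, τ.instr, .inl τ.target⟩) ''
      A.rules ∪
    (((fun q : Q => ⟨.inl q, none, .tt, .id, .inr false⟩) '' A.final) ∪
    {⟨.inr false, none, .tt, .down, .inr false⟩,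
      ⟨.inr false, none, .eq none, .id, .inr true⟩,
      ⟨.inr true, none, .eq none, .push 1 c, .inr false⟩})
  finite_rules := (A.finite_rules.image _).union
    ((A.final.toFinite.image _).union (Set.toFinite _))
  final := {.inr true}

section returning

variable [Finite Q] (A : TSA Q C α) (c : C)

/-- Invariant: states `inl q` simulate `A`. The simulation is left only from a final state, and
afterwards only the empty word is read. The state `inr true` is entered only through the test for
`@`. -/
theorem returning_run_spec (R : (A.returning c).Run) :
    ∀ j ≤ R.len,
      match R.state j with
      | .inl q => A.Reaches q (R.stack j) (R.read 0 j)
      | .inr false => R.read 0 j ∈ A.language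
      | .inr true => R.read 0 j ∈ A.language ∧ R.ptr j = [] := by
  intro j hj
  refine R.induction_on_prefix (a := 0) (P := fun j =>
      match R.state j with
      | .inl q => A.Reaches q (R.stack j) (R.read 0 j)
      | .inr false => R.read 0 j ∈ A.language
      | .inr true => R.read 0 j ∈ A.language ∧ R.ptr j = []) hj ?_ ?_ j (Nat.zero_le _) le_rfl
  · rw [R.state_zero, R.stack_zero, R.read_self]
    exact .nil ⟨A.initial, none, .tt, .id, A.initial⟩
  · intro j _ _ hj ih
    have hs := R.source_eq j hj
    have ht := R.target_eq j hj
    have hm := R.maps j hj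
    rw [R.read_succ (Nat.zero_le _)]
    rw [← hs] at ih
    rw [← ht]
    rcases R.rule_mem j hj with ⟨τ, hτ, h⟩ | ⟨q, hq, h⟩ | h | h | h
    · rw [← h] at ih hm ⊢
      exact Reaches.step ih hτ rfl rfl hm
    · rw [← h] at ih ⊢
      simpa using mem_language_iff.2 ⟨q, hq, _, ih⟩
    · rw [h] at ih ⊢
      simpa using ih
    · rw [h] at ih hm ⊢
      obtain ⟨hp, hm⟩ := hm
      have hp' := ((R.stack j).tree.label_eq_at_iff _).1 hp
      have hm' : R.stack (j + 1) = R.stack j := hm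
      exact ⟨by simpa using ih, by rw [Run.ptr, hm', hp']⟩
    · rw [h] at ih ⊢
      simpa using ih.1

theorem returning_reachesWithin {k : ℕ} {w : List α} (hw : w ∈ A.language)
    (hA : A.IsRestricted k) :
    ∃ t, (A.returning c).ReachesWithin k (.inr true) t w := by
  obtain ⟨R, ⟨hR, hw⟩, hk⟩ := hA w hw
  have h1 : (A.returning c).ReachesWithin k (.inl (R.state R.len)) (R.stack R.len) w :=
    ⟨⟨R.len, fun i => ⟨.inl (R.rule i).source, (R.rule i).letter, (R.rule i).pred,
        (R.rule i).instr, .inl (R.rule i).target⟩,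
      fun i => .inl (R.state i), R.stack, congrArg _ R.state_zero, R.stack_zero,
      fun i hi => Or.inl ⟨_, R.rule_mem i hi, rfl⟩, fun i hi => congrArg _ (R.source_eq i hi),
      fun i hi => congrArg _ (R.target_eq i hi), R.maps⟩, rfl, rfl, hw, hk⟩
  have h2 : (A.returning c).ReachesWithin k (.inr false) (R.stack R.len) w :=
    h1.step (Or.inr (Or.inl ⟨_, hR, rfl⟩)) rfl rfl ⟨trivial, rfl⟩ rfl (by simp) (by simp)
  have h3 : ∀ ν : Address, ∀ t, t.pointer = ν → (A.returning c).ReachesWithin k (.inr false) t w →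
      ∃ t, t.pointer = [] ∧ (A.returning c).ReachesWithin k (.inr false) t w := by
    intro ν
    induction ν with
    | nil => exact fun t ht h => ⟨t, ht, h⟩
    | cons n ν ih =>
      intro t ht h
      exact ih (t.parent ν n ht) rfl (h.step (Or.inr (Or.inr (Or.inl rfl))) rfl rfl
        ⟨trivial, rfl, n, ht⟩ rfl (by simp) (by simp))
  obtain ⟨t, ht, h4⟩ := h3 _ _ rfl h2
  exact ⟨t, h4.step (Or.inr (Or.inr (Or.inr (Or.inl rfl)))) rfl rfl
    ⟨(t.tree.label_eq_at_iff _).2 ht, rfl⟩ rfl (by simp) (by simp)⟩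

theorem language_returning {k : ℕ} (hA : A.IsRestricted k) :
    (A.returning c).language = A.language := by
  apply Set.Subset.antisymm
  · rintro w ⟨R, hR, rfl⟩
    have := A.returning_run_spec c R R.len le_rfl
    have hR' : R.state R.len = .inr true := hR
    rw [hR'] at this
    exact this.1
  · intro w hw
    obtain ⟨t, R, h, -, hr, -⟩ := A.returning_reachesWithin c hw hA
    exact ⟨R, h, hr⟩

theorem isRestricted_returning {k : ℕ} (hA : A.IsRestricted k) :
    (A.returning c).IsRestricted k := by
  intro w hw
  rw [A.language_returning c hA] at hw
  obtain ⟨t, R, h, -, hr, hk⟩ := A.returning_reachesWithin c hw hA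
  exact ⟨R, ⟨h, hr⟩, hk⟩

theorem returnsToRoot_returning : (A.returning c).ReturnsToRoot := by
  intro R hR
  have := A.returning_run_spec c R R.len le_rfl
  have hR' : R.state R.len = .inr true := hR
  rw [hR'] at this
  exact this.2

theorem hasPush_returning : (A.returning c).HasPush :=
  ⟨_, Or.inr (Or.inr (Or.inr (Or.inr rfl))), 1, c, rfl⟩

end returning

/-! ### Standardisation -/

/-- The idle rule `τ₃` achieves the same as the idle rules `τ₁` and `τ₂` in succession. -/
structure IsIdleComposite (τ₁ τ₂ τ₃ : Transition Q C α) : Prop where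
  idle : τ₃.IsIdle
  source : τ₃.source = τ₁.source
  target : τ₃.target = τ₂.target
  maps : ∀ t t'' : TreeStack C, τ₃.Maps t t'' ↔ ∃ t', τ₁.Maps t t' ∧ τ₂.Maps t' t''

/-- After a `set(c)` the second predicate has a constant truth value; after `id` the two predicates
must be merged into one. Both could fail for contradictory predicates, which applicability to some
tree stack excludes. -/
theorem exists_isIdleComposite {τ₁ τ₂ : Transition Q C α} (h₁ : τ₁.IsIdle) (h₂ : τ₂.IsIdle)
    (h : ∃ t t' t'' : TreeStack C, τ₁.Maps t t' ∧ τ₂.Maps t' t'') :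
    ∃ τ₃, IsIdleComposite τ₁ τ₂ τ₃ := by
  obtain ⟨q, x, p₁, f₁, q'⟩ := τ₁
  obtain ⟨r, y, p₂, f₂, r'⟩ := τ₂
  obtain ⟨hx, h₁⟩ := h₁
  obtain ⟨hy, h₂⟩ := h₂
  obtain ⟨t, t', t'', ⟨hp₁, hf₁⟩, hp₂, hf₂⟩ := h
  dsimp only at hx hy h₁ h₂ hp₁ hp₂ hf₁ hf₂
  rcases h₁ with rfl | ⟨c, rfl⟩
  · obtain rfl : t' = t := hf₁
    obtain ⟨p₃, hp₃⟩ : ∃ p₃ : StackPred C, ∀ t, p₃.Holds t ↔ p₁.Holds t ∧ p₂.Holds t := by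
      cases p₁ with
      | tt => exact ⟨p₂, fun t => by simp [StackPred.Holds]⟩
      | eq c =>
        refine ⟨.eq c, fun t => ?_⟩
        cases p₂ with
        | tt => simp [StackPred.Holds]
        | eq c' =>
          obtain rfl : c = c' := Option.some_injective _ (hp₁.symm.trans hp₂)
          simp
    refine ⟨⟨q, none, p₃, f₂, r'⟩, ⟨rfl, h₂⟩, rfl, rfl, fun t t'' => ?_⟩
    constructor
    · rintro ⟨hp, hf⟩
      rw [hp₃] at hp
      exact ⟨t, ⟨hp.1, rfl⟩, hp.2, hf⟩
    · rintro ⟨t', ⟨hp, hf⟩, hp', hf'⟩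
      obtain rfl : t' = t := hf
      exact ⟨(hp₃ _).2 ⟨hp, hp'⟩, hf'⟩
  · have hp₂' : ∀ s : TreeStack C, s.tree.label s.pointer = some (some c) → p₂.Holds s := by
      intro s hs
      cases p₂ with
      | tt => trivial
      | eq c' =>
        have h : t'.tree.label t'.pointer = some c' := hp₂
        rw [hf₁.2.1, hf₁.2.2, Function.update_self] at h
        exact hs.trans h
    rcases h₂ with rfl | ⟨c', rfl⟩
    · refine ⟨⟨q, none, p₁, .set c, r'⟩, ⟨rfl, .inr ⟨_, rfl⟩⟩, rfl, rfl, fun t t'' => ?_⟩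
      constructor
      · rintro ⟨hp, hf⟩
        exact ⟨t'', ⟨hp, hf⟩, hp₂' _ (by rw [hf.2.1, hf.2.2, Function.update_self]), rfl⟩
      · rintro ⟨t', ⟨hp, hf⟩, hp', hf'⟩
        obtain rfl : t'' = t' := hf'
        exact ⟨hp, hf⟩
    · refine ⟨⟨q, none, p₁, .set c', r'⟩, ⟨rfl, .inr ⟨_, rfl⟩⟩, rfl, rfl, fun t t'' => ?_⟩
      constructor
      · rintro ⟨hp, h0, hf, hf'⟩
        refine ⟨t.relabel h0 c, ⟨hp, h0, rfl, rfl⟩, hp₂' _ (Function.update_self ..), h0, ?_, hf'⟩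
        rw [hf]
        exact (Function.update_idem ..).symm
      · rintro ⟨t', ⟨hp, h0, hf, hf'⟩, hp', h0', hg, hg'⟩
        refine ⟨hp, h0, ?_, hg'.trans hf'⟩
        rw [hg, hf, hf', Function.update_idem]

/-- The closure of the idle rules of `A` under composition. -/
inductive IsIdleClosure (A : TSA Q C α) : Transition Q C α → Prop
  | base {τ} : τ ∈ A.rules → τ.IsIdle → IsIdleClosure A τ
  | comp {τ₁ τ₂ τ₃} : IsIdleClosure A τ₁ → IsIdleClosure A τ₂ → τ₁.target = τ₂.source →
      IsIdleComposite τ₁ τ₂ τ₃ → IsIdleClosure A τ₃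

theorem IsIdleClosure.isIdle {A : TSA Q C α} {τ : Transition Q C α} (h : A.IsIdleClosure τ) :
    τ.IsIdle := by
  cases h with
  | base _ h => exact h
  | comp _ _ _ h => exact h.idle

theorem IsIdleClosure.reaches {A : TSA Q C α} {τ : Transition Q C α} (h : A.IsIdleClosure τ)
    {t t' : TreeStack C} {w : List α} (hr : A.Reaches τ.source t w) (hm : τ.Maps t t') :
    A.Reaches τ.target t' w := by
  induction h generalizing t t' with
  | base hτ hi => simpa [hi.1] using hr.step hτ rfl rfl hm
  | comp h₁ h₂ hst hc ih₁ ih₂ =>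
    obtain ⟨s, hs, hs'⟩ := (hc.maps _ _).1 hm
    rw [hc.target]
    exact ih₂ (hst ▸ ih₁ (hc.source ▸ hr) hs) hs'

/-- An idle rule is coded by two states, an optional tested label and an optional new label. -/
theorem finite_setOf_isIdle [Finite Q] [Finite C] :
    {τ : Transition Q C α | τ.IsIdle}.Finite := by
  refine (Set.finite_range (fun x : Q × Option (Option C) × Option C × Q =>
    (⟨x.1, none, x.2.1.elim .tt .eq, x.2.2.1.elim .id .set, x.2.2.2⟩ :
      Transition Q C α))).subset ?_
  rintro ⟨q, x, p, f, q'⟩ ⟨hx, hf⟩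
  dsimp only at hx hf
  subst hx
  have hp : ∃ o : Option (Option C), o.elim .tt .eq = p := by
    cases p with
    | tt => exact ⟨none, rfl⟩
    | eq c => exact ⟨some c, rfl⟩
  have hf' : ∃ o : Option C, o.elim .id .set = f := by
    rcases hf with rfl | ⟨c, rfl⟩
    · exact ⟨none, rfl⟩
    · exact ⟨some c, rfl⟩
  obtain ⟨o, rfl⟩ := hp
  obtain ⟨o', rfl⟩ := hf'
  exact ⟨⟨q, o, o', q'⟩, rfl⟩

/-- The automaton with all composites of idle rules added. -/
def standardise [Finite Q] [Finite C] (A : TSA Q C α) : TSA Q C α where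
  initial := A.initial
  rules := A.rules ∪ {τ | A.IsIdleClosure τ}
  finite_rules := A.finite_rules.union (finite_setOf_isIdle.subset fun _ h => h.isIdle)
  final := A.final

section standardise

variable [Finite Q] [Finite C] (A : TSA Q C α)

theorem isStandardised_standardise : A.standardise.IsStandardised := by
  have key : ∀ τ ∈ A.standardise.rules, τ.IsIdle → A.IsIdleClosure τ := by
    rintro τ (hτ | hτ) hi
    · exact .base hτ hi
    · exact hτ
  intro τ₁ h₁ τ₂ h₂ hi₁ hi₂ hst h
  obtain ⟨τ₃, h₃⟩ := exists_isIdleComposite hi₁ hi₂ h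
  exact ⟨τ₃, Or.inr (.comp (key _ h₁ hi₁) (key _ h₂ hi₂) hst h₃), h₃.idle, h₃.source, h₃.target,
    h₃.maps⟩

variable {A}

theorem Reaches.of_standardise {q : Q} {t : TreeStack C} {w : List α}
    (h : A.standardise.Reaches q t w) : A.Reaches q t w := by
  obtain ⟨R, rfl, rfl, rfl⟩ := h
  refine R.induction_on_prefix (a := 0)
    (P := fun j => A.Reaches (R.state j) (R.stack j) (R.read 0 j)) le_rfl ?_ ?_ _
      (Nat.zero_le _) le_rfl
  · rw [R.state_zero, R.stack_zero, R.read_self]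
    exact .nil (R.rule 0)
  · intro j _ _ hj ih
    rw [R.read_succ (Nat.zero_le _)]
    rcases R.rule_mem j hj with h | h
    · exact ih.step h (R.source_eq j hj) (R.target_eq j hj) (R.maps j hj)
    · rw [h.isIdle.1, ← R.target_eq j hj]
      simpa using h.reaches (R.source_eq j hj ▸ ih) (R.maps j hj)

/-- A run, seen as a run of the standardised automaton. -/
def Run.toStandardise (R : A.Run) : A.standardise.Run :=
  { R with rule_mem := fun i hi => Or.inl (R.rule_mem i hi) }

theorem language_standardise : A.standardise.language = A.language := by
  apply Set.Subset.antisymm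
  · intro w hw
    obtain ⟨q, hq, t, h⟩ := mem_language_iff.1 hw
    exact mem_language_iff.2 ⟨q, hq, t, h.of_standardise⟩
  · rintro w ⟨R, hR, hw⟩
    exact ⟨R.toStandardise, hR, hw⟩

theorem IsRestricted.standardise {k : ℕ} (h : A.IsRestricted k) :
    A.standardise.IsRestricted k := by
  intro w hw
  rw [language_standardise] at hw
  obtain ⟨R, hR, hk⟩ := h w hw
  exact ⟨R.toStandardise, hR, hk⟩

theorem ReturnsToRoot.standardise (h : A.ReturnsToRoot) : A.standardise.ReturnsToRoot := by
  intro R hR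
  obtain ⟨R', hs, ht, -⟩ := Reaches.of_standardise ⟨R, rfl, rfl, rfl⟩
  rw [Run.ptr, ← ht]
  exact h R' (hs ▸ hR)

theorem HasPush.standardise (h : A.HasPush) : A.standardise.HasPush := by
  obtain ⟨τ, hτ, h⟩ := h
  exact ⟨τ, Or.inl hτ, h⟩

end standardise

end TSA

/-- `returning` needs a label to push, hence the case of empty `C`. It also creates new idle rules,
so standardisation comes last; that step preserves the other properties. -/
theorem IsMCF.exists_isStandardAcceptor {α : Type*} {k : ℕ} {L : Language α} (hL : IsMCF k L) :
    ∃ (Q C : Type) (_ : Finite Q) (_ : Finite C) (A : TSA Q C α), A.IsStandardAcceptor k L := by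
  have key : ∀ (Q C : Type) (_ : Finite Q) (_ : Finite C) (_ : C) (A : TSA Q C α),
      A.language = L → A.IsRestricted k →
      ∃ (Q C : Type) (_ : Finite Q) (_ : Finite C) (A : TSA Q C α), A.IsStandardAcceptor k L := by
    intro Q C _ _ c A hA hk
    exact ⟨Q ⊕ Bool, C, inferInstance, inferInstance, (A.returning c).standardise,
      by rw [TSA.language_standardise, A.language_returning c hk, hA],
      (A.isRestricted_returning c hk).standardise, TSA.isStandardised_standardise _,
      (A.returnsToRoot_returning c).standardise, (A.hasPush_returning c).standardise⟩
  obtain ⟨Q, C, hQ, hC, A, hA, hk⟩ := hL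
  rcases isEmpty_or_nonempty C with h | ⟨⟨c⟩⟩
  · exact key Q Unit hQ inferInstance () A.withUnitLabel (A.language_withUnitLabel.trans hA)
      (A.isRestricted_withUnitLabel k)
  · exact key Q C hQ hC c A hA hk

/-! ### Interleaved words -/

theorem interleave_succ_last {α : Type*} {s : ℕ} (w : Fin (s + 2) → List α)
    (u : Fin (s + 1) → List α) :
    interleave w u = interleave (fun j => w j.castSucc) (fun j => u j.castSucc) ++
      u (Fin.last s) ++ w (Fin.last (s + 1)) := by
  simp only [interleave, List.ofFn_succ', List.concat_eq_append, List.flatten_append]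
  simp

/-- Runs grow at their end, so interleaved words are built from the left, one pair `uᵢ wᵢ` at a
time. -/
theorem interleave_induction {α : Type*} {s : ℕ} (w : Fin (s + 1) → List α)
    (u : Fin s → List α) (P : Fin (s + 1) → List α → Prop) (zero : P 0 (w 0))
    (succ : ∀ (i : Fin s) x, P i.castSucc x → P i.succ (x ++ u i ++ w i.succ)) :
    P (Fin.last s) (interleave w u) := by
  induction s with
  | zero => simpa [interleave] using zero
  | succ s ih =>
    rw [interleave_succ_last]
    exact succ (Fin.last s) _
      (ih (fun j => w j.castSucc) (fun j => u j.castSucc) (fun j => P j.castSucc) zero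
        fun i x hx => succ i.castSucc x hx)

theorem length_interleave {α : Type*} {s : ℕ} (w : Fin (s + 1) → List α)
    (u : Fin s → List α) :
    (interleave w u).length = ∑ j, (w j).length + ∑ j, (u j).length := by
  induction s with
  | zero => simp [interleave]
  | succ s ih =>
    rw [interleave_succ_last, List.length_append, List.length_append, ih,
      Fin.sum_univ_castSucc (fun j => (w j).length), Fin.sum_univ_castSucc (fun j => (u j).length)]
    omega

/-- Used to carry a factorisation of the unmarked word over to the marked one. -/
theorem exists_interleave_of_map_eq {α β : Type*} (f : β → α) {s : ℕ} {x : List β}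
    {w : Fin (s + 1) → List α} {u : Fin s → List α} (h : x.map f = interleave w u) :
    ∃ (w' : Fin (s + 1) → List β) (u' : Fin s → List β), x = interleave w' u' ∧
      (∀ j, (w' j).map f = w j) ∧ ∀ j, (u' j).map f = u j := by
  induction s generalizing x with
  | zero =>
    refine ⟨fun _ => x, fun _ => x, by simp [interleave], fun j => ?_, fun j => j.elim0⟩
    rw [h, Fin.fin_one_eq_zero j]
    simp [interleave]
  | succ s ih =>
    rw [interleave_succ_last, List.map_eq_append_iff] at h
    obtain ⟨y, z, rfl, hy, hz⟩ := h
    rw [List.map_eq_append_iff] at hy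
    obtain ⟨y, v, rfl, hy, hv⟩ := hy
    obtain ⟨w', u', rfl, hw, hu⟩ := ih hy
    refine ⟨Fin.snoc w' z, Fin.snoc u' v, ?_, fun j => ?_, fun j => ?_⟩
    · simp [interleave_succ_last]
    · cases j using Fin.lastCases with
      | last => simpa using hz
      | cast j => simpa using hw j
    · cases j using Fin.lastCases with
      | last => simpa using hv
      | cast j => simpa using hu j

/-! ### Transitions at the root -/

theorem StackPred.Holds.of_label_eq {C : Type*} {p : StackPred C} {t s : TreeStack C}
    (h : p.Holds t) (hts : s.tree.label s.pointer = t.tree.label t.pointer) : p.Holds s := by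
  cases p with
  | tt => trivial
  | eq c => exact hts.trans h

theorem TreeStack.label_pointer_of_root {C : Type*} {t : TreeStack C} (h : t.pointer = []) :
    t.tree.label t.pointer = some none :=
  (t.tree.label_eq_at_iff _).2 h

namespace Instr.Maps

variable {C : Type*} {f : Instr C} {t t' : TreeStack C}

theorem label_ne_none (h : f.Maps t t') {ν : Address} (hν : t.tree.label ν ≠ none) :
    t'.tree.label ν ≠ none := by
  cases f with
  | id => obtain rfl : t' = t := h; exact hν
  | push n c =>
    rw [h.2.1]
    by_cases h' : ν = n :: t.pointer
    · simp [h']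
    · rwa [Function.update_of_ne h']
  | up n => rwa [h.2.1]
  | down => rwa [h.1]
  | set c =>
    rw [h.2.1]
    by_cases h' : ν = t.pointer
    · simp [h']
    · rwa [Function.update_of_ne h']

theorem eq_pointer_of_label_ne_none (h : f.Maps t t') {ν : Address}
    (hν : t.tree.label ν = none) (hν' : t'.tree.label ν ≠ none) :
    t'.pointer = ν ∧ ∃ n, ν = n :: t.pointer := by
  cases f with
  | id => obtain rfl : t' = t := h; exact absurd hν hν'
  | push n c =>
    rw [h.2.1] at hν'
    by_cases h' : ν = n :: t.pointer
    · exact ⟨h.2.2.trans h'.symm, n, h'⟩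
    · rw [Function.update_of_ne h'] at hν'
      exact absurd hν hν'
  | up n => rw [h.2.1] at hν'; exact absurd hν hν'
  | down => rw [h.1] at hν'; exact absurd hν hν'
  | set c =>
    rw [h.2.1] at hν'
    by_cases h' : ν = t.pointer
    · exact absurd (h' ▸ hν) t.pointer_mem
    · rw [Function.update_of_ne h'] at hν'
      exact absurd hν hν'

/-- `set` is undefined at the root, and the remaining instructions move the pointer. -/
theorem eq_id_of_root (h : f.Maps t t') (ht : t.pointer = []) (ht' : t'.pointer = []) :
    f = .id := by
  cases f with
  | id => rfl
  | push n c => simp [h.2.2] at ht'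
  | up n => simp [h.2.2] at ht'
  | down => obtain ⟨-, n, h⟩ := h; simp [h] at ht
  | set c => exact absurd ht h.1

theorem eq_down_of_root (h : f.Maps t t') (ht : t.pointer ≠ []) (ht' : t'.pointer = []) :
    f = .down := by
  cases f with
  | id => obtain rfl : t' = t := h; exact absurd ht' ht
  | push n c => simp [h.2.2] at ht'
  | up n => simp [h.2.2] at ht'
  | down => rfl
  | set c => exact absurd (h.2.2.symm.trans ht') ht

theorem eq_push_or_up_of_root (h : f.Maps t t') (ht : t.pointer = []) {n : ℕ+} {ν : Address}
    (ht' : t'.pointer = n :: ν) : ν = [] ∧ ((∃ c, f = .push n c) ∨ f = .up n) := by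
  cases f with
  | id => obtain rfl : t' = t := h; simp [ht] at ht'
  | push m c =>
    have := h.2.2.symm.trans ht'
    simp_all
  | up m =>
    have := h.2.2.symm.trans ht'
    simp_all
  | down => obtain ⟨-, m, h⟩ := h; simp [h] at ht
  | set c => exact absurd ht h.1

/-- Addresses are reversed, so the last list entry is the child of the root below the pointer. It
cannot change without passing through the root. -/
theorem exists_pointer_eq_append (h : f.Maps t t') {n : ℕ+}
    (ht : ∃ ν, t.pointer = ν ++ [n]) (ht' : t'.pointer ≠ []) : ∃ ν, t'.pointer = ν ++ [n] := by
  obtain ⟨ν, ht⟩ := ht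
  cases f with
  | id => obtain rfl : t' = t := h; exact ⟨ν, ht⟩
  | push m c => exact ⟨m :: ν, by simp [h.2.2, ht]⟩
  | up m => exact ⟨m :: ν, by simp [h.2.2, ht]⟩
  | down =>
    obtain ⟨-, m, h⟩ := h
    cases ν with
    | nil => simp_all
    | cons a ν => exact ⟨ν, by simp_all⟩
  | set c => exact ⟨ν, h.2.2.trans ht⟩

end Instr.Maps

namespace Transition.Maps

variable {Q C α : Type*} {τ τ' : Transition Q C α} {t t' s s' : TreeStack C}

theorem self_of_root (h : τ.Maps t t') (ht : t.pointer = []) (ht' : t'.pointer = [])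
    (hs : s.pointer = []) : τ.Maps s s := by
  refine ⟨h.1.of_label_eq ?_, ?_⟩
  · rw [TreeStack.label_pointer_of_root ht, TreeStack.label_pointer_of_root hs]
  · rw [h.2.eq_id_of_root ht ht']
    rfl

/-- Whether the rule pushes or goes up depends on whether the child exists, which is the same for
`t` and `s`. Two pushes agree because the resulting labels do. -/
theorem transfer_up (h : τ.Maps t t') (h' : τ'.Maps s s') {n : ℕ+} (ht : t.pointer = [])
    (hs : s.pointer = []) (ht' : t'.pointer = [n]) (hs' : s'.pointer = [n])
    (hdom : t.tree.label [n] ≠ none ↔ s.tree.label [n] ≠ none)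
    (hlabel : t'.tree.label [n] = s'.tree.label [n]) : τ.Maps s s' := by
  refine ⟨h.1.of_label_eq ?_, ?_⟩
  · rw [TreeStack.label_pointer_of_root ht, TreeStack.label_pointer_of_root hs]
  have h1 := h.2
  have h2 := h'.2
  rcases (h1.eq_push_or_up_of_root ht ht').2 with ⟨c, hf⟩ | hf <;>
  rcases (h2.eq_push_or_up_of_root hs hs').2 with ⟨d, hg⟩ | hg <;>
  rw [hf] at h1 ⊢ <;> rw [hg] at h2
  · rw [h1.2.1, h2.2.1, ht, hs, Function.update_self, Function.update_self] at hlabel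
    obtain rfl : c = d := by simpa using hlabel
    exact h2
  · have h3 := h1.1
    have h4 := h2.1
    rw [ht] at h3
    rw [hs] at h4
    exact absurd h3 (hdom.2 h4)
  · have h3 := h1.1
    have h4 := h2.1
    rw [ht] at h3
    rw [hs] at h4
    exact absurd h4 (hdom.1 h3)
  · exact h2

theorem transfer_down (h : τ.Maps t t') (h' : τ'.Maps s s') (ht : t.pointer ≠ [])
    (hs : s.pointer ≠ []) (ht' : t'.pointer = []) (hs' : s'.pointer = [])
    (hlabel : s.tree.label s.pointer = t.tree.label t.pointer) : τ.Maps s s' := by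
  refine ⟨h.1.of_label_eq hlabel, ?_⟩
  rw [h.2.eq_down_of_root ht ht', ← h'.2.eq_down_of_root hs hs']
  exact h'.2

end Transition.Maps

/-! ### Phases of a run at the root -/

namespace TSA

variable {Q C α : Type*} {A : TSA Q C α}

namespace Run

theorem label_ne_none_mono (R : A.Run) {i j : ℕ} (hij : i ≤ j) (hj : j ≤ R.len) {ν : Address}
    (h : (R.stack i).tree.label ν ≠ none) : (R.stack j).tree.label ν ≠ none :=
  R.induction_on_prefix (P := fun j => (R.stack j).tree.label ν ≠ none) hj h
    (fun j _ _ hj ih => (R.maps j hj).2.label_ne_none ih) j hij le_rfl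

theorem stack_eq_of_root (R : A.Run) {a b : ℕ} (hb : b ≤ R.len)
    (h : ∀ j, a ≤ j → j ≤ b → R.ptr j = []) : ∀ j, a ≤ j → j ≤ b → R.stack j = R.stack a := by
  refine R.induction_on_prefix (P := fun j => R.stack j = R.stack a) hb rfl
    fun j haj hjb hj ih => ?_
  have hm := (R.maps j hj).2
  rw [hm.eq_id_of_root (h j haj hjb.le) (h (j + 1) (by omega) hjb)] at hm
  exact Eq.trans hm ih

theorem reaches_of_root (R : A.Run) {a b : ℕ} (hab : a ≤ b) (hb : b ≤ R.len)
    (h : ∀ j, a ≤ j → j ≤ b → R.ptr j = []) {t : TreeStack C} (ht : t.pointer = [])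
    {x : List α} (hx : A.Reaches (R.state a) t x) :
    A.Reaches (R.state b) t (x ++ R.read a b) := by
  refine R.induction_on_prefix (P := fun j => A.Reaches (R.state j) t (x ++ R.read a j)) hb
    (by simpa [R.read_self] using hx) (fun j haj hjb hj ih => ?_) b hab le_rfl
  rw [R.read_succ haj, ← List.append_assoc]
  exact ih.step (R.rule_mem j hj) (R.source_eq j hj) (R.target_eq j hj)
    ((R.maps j hj).self_of_root (h j haj hjb.le) (h (j + 1) (by omega) hjb) ht)

/-- The indices at which the factors outside of the excursions start. -/
def segStart {s : ℕ} (m : Fin s → ℕ) : Fin (s + 1) → ℕ := Fin.cons 0 m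

/-- The indices at which the factors outside of the excursions end. -/
def segEnd (R : A.Run) {s : ℕ} (l : Fin s → ℕ) : Fin (s + 1) → ℕ :=
  Fin.snoc (α := fun _ => ℕ) l R.len

/-- The indices at which the phases at the root start. -/
def rootStart {s : ℕ} (m : Fin s → ℕ) : Fin (s + 1) → ℕ := Fin.cons 0 fun i => m i + 1

/-- The indices at which the phases at the root end. -/
def rootEnd (R : A.Run) {s : ℕ} (l : Fin s → ℕ) : Fin (s + 1) → ℕ :=
  Fin.snoc (α := fun _ => ℕ) (fun i => l i - 1) R.len

/-- The factors of the input read outside of the excursions from the root. -/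
def outer (R : A.Run) {s : ℕ} (l m : Fin s → ℕ) (e : Fin (s + 1)) : List α :=
  R.read (segStart m e) (R.segEnd l e)

section simp

variable (R : A.Run) {s : ℕ} (l m : Fin s → ℕ) (i : Fin s)

@[simp] theorem segStart_zero : segStart m 0 = 0 := rfl
@[simp] theorem segStart_succ : segStart m i.succ = m i := by simp [segStart]
@[simp] theorem rootStart_zero : rootStart m 0 = 0 := rfl
@[simp] theorem rootStart_succ : rootStart m i.succ = m i + 1 := by simp [rootStart]
@[simp] theorem segEnd_castSucc : R.segEnd l i.castSucc = l i := by simp [segEnd]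
@[simp] theorem segEnd_last : R.segEnd l (Fin.last s) = R.len := by simp [segEnd]
@[simp] theorem rootEnd_castSucc : R.rootEnd l i.castSucc = l i - 1 := by simp [rootEnd]
@[simp] theorem rootEnd_last : R.rootEnd l (Fin.last s) = R.len := by simp [rootEnd]

end simp

namespace IsLevelOneArray

variable {R : A.Run} {s : ℕ} {l m : Fin s → ℕ} {n : Fin s → ℕ+}

/-- The pointer is at the root at time `l i' - 1`, so this time lies beyond `m i`. Hence root phases
have valid bounds. -/
theorem lt_of_lt (h : R.IsLevelOneArray l m n) {i i' : Fin s} (hi : i < i') :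
    m i + 1 < l i' := by
  have h1 := h.strictMono hi
  have h2 := h.pos i'
  by_contra hc
  exact h.ptr_between i (l i' - 1) (by omega) (by omega) (h.ptr_before i')

theorem ptr_between_eq (h : R.IsLevelOneArray l m n) (i : Fin s) :
    ∀ j, l i ≤ j → j ≤ m i → ∃ ν, R.ptr j = ν ++ [n i] :=
  R.induction_on_prefix (h.lt_len i).le ⟨[], h.ptr_start i⟩ fun j hlj hjm hj ih =>
    (R.maps j hj).2.exists_pointer_eq_append ih (h.ptr_between i (j + 1) (by omega) hjm)

theorem ptr_end (h : R.IsLevelOneArray l m n) (i : Fin s) : R.ptr (m i) = [n i] := by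
  obtain ⟨ν, hν⟩ := h.ptr_between_eq i _ (h.le i) le_rfl
  have hm := (R.maps _ (h.lt_len i)).2
  rw [hm.eq_down_of_root (h.ptr_between i _ (h.le i) le_rfl) (h.ptr_after i)] at hm
  obtain ⟨-, k, hk⟩ := hm
  have h' : (R.stack (m i + 1)).pointer = [] := h.ptr_after i
  rw [h'] at hk
  have h2 : ν ++ [n i] = [k] := hν.symm.trans hk
  cases ν with
  | nil => exact hν
  | cons a ν => simp at h2

/-- Children of the root are created only when an excursion starts, and are never removed. So the
history alone determines which of them exist. -/
theorem child_mem_iff (h : R.IsLevelOneArray l m n) {j : ℕ} (hj : j ≤ R.len) (x : ℕ+) :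
    (R.stack j).tree.label [x] ≠ none ↔ ∃ i, l i ≤ j ∧ n i = x := by
  constructor
  · refine R.induction_on_prefix (a := 0)
      (P := fun j => (R.stack j).tree.label [x] ≠ none → ∃ i, l i ≤ j ∧ n i = x) hj ?_ ?_ j
      (Nat.zero_le _) le_rfl
    · simp [R.stack_zero, TreeStack.initial]
    · intro j _ _ hj ih hx
      by_cases hx' : (R.stack j).tree.label [x] = none
      · obtain ⟨hp, k, hk⟩ := (R.maps j hj).2.eq_pointer_of_label_ne_none hx' hx
        have hp' : R.ptr (j + 1) = [x] := hp
        have hk' : R.ptr j = [] := (List.cons_eq_cons.1 hk).2.symm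
        obtain ⟨i, hi⟩ := h.complete j hj hk' (by simp [hp'])
        have := h.ptr_start i
        rw [hi, hp'] at this
        exact ⟨i, hi.le, by simpa using this.symm⟩
      · obtain ⟨i, hi, hn⟩ := ih hx'
        exact ⟨i, by omega, hn⟩
  · rintro ⟨i, hi, rfl⟩
    refine R.label_ne_none_mono hi hj ?_
    have := (R.stack (l i)).pointer_mem
    rwa [show (R.stack (l i)).pointer = [n i] from h.ptr_start i] at this

theorem rootStart_le_rootEnd (h : R.IsLevelOneArray l m n) (e : Fin (s + 1)) :
    rootStart m e ≤ R.rootEnd l e := by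
  cases e using Fin.lastCases with
  | last =>
    rw [rootEnd_last]
    generalize Fin.last s = e
    cases e using Fin.cases with
    | zero => simp
    | succ i => simpa using h.lt_len i
  | cast i =>
    rw [rootEnd_castSucc]
    generalize he : i.castSucc = e
    cases e using Fin.cases with
    | zero => simp
    | succ i' =>
      have : i' < i := by
        rw [Fin.lt_def]
        have := congrArg Fin.val he
        simp at this
        omega
      have := h.lt_of_lt this
      simp
      omega

theorem rootEnd_le_len (h : R.IsLevelOneArray l m n) (e : Fin (s + 1)) :
    R.rootEnd l e ≤ R.len := by
  cases e using Fin.lastCases with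
  | last => simp
  | cast i =>
    have := h.le i
    have := h.lt_len i
    simp
    omega

theorem ptr_root (h : R.IsLevelOneArray l m n) (e : Fin (s + 1)) :
    ∀ j, rootStart m e ≤ j → j ≤ R.rootEnd l e → R.ptr j = [] := by
  refine R.induction_on_prefix (h.rootEnd_le_len e) ?_ fun j hj hj' hjl ih => ?_
  · cases e using Fin.cases with
    | zero => simp [ptr, R.stack_zero, TreeStack.initial]
    | succ i => simpa using h.ptr_after i
  -- Leaving the root here would start an excursion no earlier than the one that ends phase `e`, yet
  -- before its starting time.
  · by_contra hp
    obtain ⟨i, hi⟩ := h.complete j hjl ih hp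
    have h1 : e ≤ i.castSucc := by
      cases e using Fin.cases with
      | zero => simp
      | succ i' =>
        simp only [rootStart_succ] at hj
        have h2 := h.le i'
        have : i' < i := h.strictMono.lt_iff_lt.1 (by omega)
        rw [Fin.le_def]
        simpa using this
    cases e using Fin.lastCases with
    | last => exact absurd h1 (by simp)
    | cast i' =>
      have h2 := h.strictMono.monotone (Fin.castSucc_le_castSucc_iff.1 h1)
      simp only [rootEnd_castSucc] at hj'
      omega

theorem segStart_le_segEnd (h : R.IsLevelOneArray l m n) (e : Fin (s + 1)) :
    segStart m e ≤ R.segEnd l e := by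
  have h1 := h.rootStart_le_rootEnd e
  have h2 : segStart m e ≤ rootStart m e := by
    cases e using Fin.cases <;> simp
  have h3 : R.rootEnd l e ≤ R.segEnd l e := by
    cases e using Fin.lastCases <;> simp
  omega

theorem read_eq_interleave (h : R.IsLevelOneArray l m n) :
    R.read 0 R.len = interleave (R.outer l m) fun i => R.read (l i) (m i) := by
  have := interleave_induction (R.outer l m) (fun i => R.read (l i) (m i))
    (fun e x => x = R.read 0 (R.segEnd l e)) rfl ?_
  · simpa using this.symm
  · rintro i x rfl
    have h1 := h.segStart_le_segEnd i.succ
    rw [segStart_succ] at h1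
    rw [segEnd_castSucc, R.read_append (Nat.zero_le _) (h.le i), outer, segStart_succ,
      R.read_append (Nat.zero_le _) h1]

end IsLevelOneArray

/-- The phases of `R` at the root can be combined with the excursions of `R'`. -/
theorem HasLevelOneHistory.reaches_interleave {R R' : A.Run} {s : ℕ} {l m l' m' : Fin s → ℕ}
    {h : LevelOneHistory Q C s} (hR : R.HasLevelOneHistory l m h)
    (hR' : R'.HasLevelOneHistory l' m' h) :
    A.Reaches (R.state R.len) (R'.stack R'.len)
      (interleave (R.outer l m) fun i => R'.read (l' i) (m' i)) := by
  have ha := hR.isArray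
  have ha' := hR'.isArray
  -- Phase `e` runs the root rules of `R` on the frozen tree stack of `R'`, then takes the first
  -- step of the next excursion, if there is one. The phases of `R` and `R'` may differ in length.
  have phase : ∀ e x, A.Reaches (R.state (rootStart m e)) (R'.stack (rootStart m' e)) x →
      A.Reaches (R.state (R.segEnd l e)) (R'.stack (R'.segEnd l' e))
        (x ++ R.read (rootStart m e) (R.segEnd l e)) := by
    intro e x hx
    have h1 := R.reaches_of_root (ha.rootStart_le_rootEnd e) (ha.rootEnd_le_len e) (ha.ptr_root e)
      (ha'.ptr_root e _ le_rfl (ha'.rootStart_le_rootEnd e)) hx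
    rw [← R'.stack_eq_of_root (ha'.rootEnd_le_len e) (ha'.ptr_root e) _
      (ha'.rootStart_le_rootEnd e) le_rfl] at h1
    have hle := ha.rootStart_le_rootEnd e
    cases e using Fin.lastCases with
    | last => simpa using h1
    | cast i =>
      simp only [rootEnd_castSucc, segEnd_castSucc] at h1 hle ⊢
      have e1 := Nat.sub_add_cancel (ha.pos i)
      have e2 := Nat.sub_add_cancel (ha'.pos i)
      have l1 : l i - 1 < R.len := by have := ha.le i; have := ha.lt_len i; omega
      have l2 : l' i - 1 < R'.len := by have := ha'.le i; have := ha'.lt_len i; omega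
      have m1 := R.maps _ l1
      have m2 := R'.maps _ l2
      have t1 := R.target_eq _ l1
      simp only [e1, e2] at m1 m2 t1
      have := h1.step (R.rule_mem _ l1) (R.source_eq _ l1) t1
        (m1.transfer_up m2 (ha.ptr_before i) (ha'.ptr_before i) (ha.ptr_start i) (ha'.ptr_start i)
          ?_ (by rw [hR.label_up, hR'.label_up]))
      · rw [List.append_assoc, ← R.read_succ hle, e1] at this
        exact this
      -- In both runs the children present before excursion `i` are those of the excursions `i' <
      -- i`.
      · rw [ha.child_mem_iff l1.le, ha'.child_mem_iff l2.le]
        have key : ∀ {R : A.Run} {l m : Fin s → ℕ} {n : Fin s → ℕ+}, R.IsLevelOneArray l m n →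
            ∀ i', l i' ≤ l i - 1 ↔ i' < i := fun ha i' => by
          rw [← ha.strictMono.lt_iff_lt]
          have := ha.pos i
          omega
        simp only [key ha, key ha']
  have := interleave_induction (R.outer l m) (fun i => R'.read (l' i) (m' i))
    (fun e x => A.Reaches (R.state (R.segEnd l e)) (R'.stack (R'.segEnd l' e)) x) ?_ ?_
  · simpa using this
  · refine phase 0 [] ?_
    simp only [rootStart_zero, R.state_zero, R'.stack_zero]
    exact .nil (R.rule 0)
  -- The configuration is now that of `R'` at time `l' i`, so `R'` itself can be followed up to `m'
  -- i`. The closing `down` is again a rule of `R`.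
  · intro i x hx
    simp only [segEnd_castSucc] at hx
    rw [hR.state_up, ← hR'.state_up] at hx
    have h1 := hx.along R' (ha'.le i) (ha'.lt_len i).le
    rw [hR'.state_down, ← hR.state_down] at h1
    have h2 := h1.step (R.rule_mem _ (ha.lt_len i)) (R.source_eq _ (ha.lt_len i))
      (R.target_eq _ (ha.lt_len i))
      ((R.maps _ (ha.lt_len i)).transfer_down (R'.maps _ (ha'.lt_len i))
        (ha.ptr_between i _ (ha.le i) le_rfl) (ha'.ptr_between i _ (ha'.le i) le_rfl)
        (ha.ptr_after i) (ha'.ptr_after i) ?_)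
    · have h3 := phase i.succ _ (by simpa only [rootStart_succ] using h2)
      have h4 := (ha.rootStart_le_rootEnd i.succ).trans
        (show R.rootEnd l i.succ ≤ R.segEnd l i.succ by
          generalize i.succ = e
          cases e using Fin.lastCases <;> simp)
      rw [rootStart_succ] at h3 h4
      rw [outer, segStart_succ, ← R.read_append (Nat.le_succ (m i)) h4,
        R.read_succ le_rfl, R.read_self]
      simpa using h3
    · have e1 : (R.stack (m i)).pointer = [h.child i] := ha.ptr_end i
      have e2 : (R'.stack (m' i)).pointer = [h.child i] := ha'.ptr_end i
      rw [e1, e2, hR.label_down, hR'.label_down]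

/-- The spliced run need be neither proper nor restricted: being valid, it puts the word into the
language. -/
theorem HasLevelOneHistory.isSwitchableFactorisation {R : A.Run} {s : ℕ} {l m : Fin s → ℕ}
    {h : LevelOneHistory Q C s} (hR : R.HasLevelOneHistory l m h)
    (hf : R.state R.len ∈ A.final) (hp : R.IsProper) :
    IsSwitchableFactorisation A.language (A.levelOneUpSet h) (R.read 0 R.len) (R.outer l m)
      (fun i => R.read (l i) (m i)) where
  mem := ⟨R, hf, rfl⟩
  eq := hR.isArray.read_eq_interleave
  factor_mem := ⟨R, hf, hp, l, m, hR, fun _ => rfl⟩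
  switch := by
    rintro v ⟨R', -, -, l', m', hR', hv⟩
    obtain rfl : v = fun i => R'.read (l' i) (m' i) := funext hv
    exact mem_language_iff.2 ⟨_, hf, _, hR.reaches_interleave hR'⟩

end Run

end TSA

namespace TSA

variable {Q C α : Type*} {A : TSA Q C α}

namespace Run

/-! ### Proper runs -/

/-- Merging shortens the run, so repeating it ends in a proper run. Idle rules enter no vertex, so
no visits from below are added. -/
theorem exists_merge (hA : A.IsStandardised) (R : A.Run) {i : ℕ} (hi : i + 1 < R.len)
    (h₁ : (R.rule i).IsIdle) (h₂ : (R.rule (i + 1)).IsIdle) :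
    ∃ R' : A.Run, R'.len < R.len ∧ R'.state R'.len = R.state R.len ∧
      R'.read 0 R'.len = R.read 0 R.len ∧ ∀ k, R.IsRestricted k → R'.IsRestricted k := by
  obtain ⟨τ, hτ, hidle, hs, ht, hm⟩ := hA _ (R.rule_mem i (by omega)) _ (R.rule_mem (i + 1) hi)
    h₁ h₂ (by rw [R.target_eq i (by omega), R.source_eq (i + 1) hi])
    ⟨_, _, _, R.maps i (by omega), R.maps (i + 1) hi⟩
  rw [R.source_eq i (by omega)] at hs
  rw [R.target_eq (i + 1) hi] at ht
  have hm := (hm _ _).2 ⟨_, R.maps i (by omega), R.maps (i + 1) hi⟩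
  let R' : A.Run :=
    { len := R.len - 1
      rule := fun j => if j < i then R.rule j else if j = i then τ else R.rule (j + 1)
      state := fun j => if j ≤ i then R.state j else R.state (j + 1)
      stack := fun j => if j ≤ i then R.stack j else R.stack (j + 1)
      state_zero := by simp [R.state_zero]
      stack_zero := by simp [R.stack_zero]
      rule_mem := fun j hj => by
        split_ifs
        · exact R.rule_mem j (by omega)
        · exact hτ
        · exact R.rule_mem (j + 1) (by omega)
      source_eq := fun j hj => by
        rcases lt_trichotomy j i with h | rfl | h
        · simpa [h, h.le] using R.source_eq j (by omega)
        · simpa using hs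
        · simpa [h.not_gt, h.ne', h.not_ge] using R.source_eq (j + 1) (by omega)
      target_eq := fun j hj => by
        rcases lt_trichotomy j i with h | rfl | h
        · simpa [h, Nat.succ_le_of_lt h] using R.target_eq j (by omega)
        · simpa using ht
        · simpa [h.not_gt, h.ne', (Nat.lt_succ_of_lt h).not_ge] using
            R.target_eq (j + 1) (by omega)
      maps := fun j hj => by
        rcases lt_trichotomy j i with h | rfl | h
        · simpa [h, h.le, Nat.succ_le_of_lt h] using R.maps j (by omega)
        · simpa using hm
        · simpa [h.not_gt, h.ne', h.not_ge, (Nat.lt_succ_of_lt h).not_ge] using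
            R.maps (j + 1) (by omega) }
  have hread : ∀ j, i + 1 ≤ j → R'.read 0 j = R.read 0 (j + 1) := by
    intro j hj
    induction j, hj using Nat.le_induction with
    | base =>
      rw [read_succ _ (Nat.zero_le _), read_succ _ (Nat.zero_le _), read_succ _ (Nat.zero_le _),
        h₁.1, h₂.1]
      have : R'.read 0 i = R.read 0 i := read_congr _ _ fun x _ hx => by simp [R', hx]
      simp [this, R', hidle.1]
    | succ j hj ih =>
      rw [read_succ _ (Nat.zero_le _), ih, read_succ _ (Nat.zero_le (j + 1))]
      have h' : ¬ j < i := by omega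
      have h'' : j ≠ i := by omega
      simp [R', h', h'']
  refine ⟨R', ?_, ?_, ?_, fun k hk ν n => ?_⟩
  · change R.len - 1 < R.len
    omega
  · have h' : ¬ R.len - 1 ≤ i := by omega
    simp only [R', h', if_false]
    rw [Nat.sub_add_cancel (by omega)]
  · rw [hread _ (by change i + 1 ≤ R.len - 1; omega)]
    change R.read 0 (R.len - 1 + 1) = _
    rw [Nat.sub_add_cancel (by omega)]
  -- Times of the merged run are sent to times of `R`, skipping `i + 1`. At time `i` itself the rule
  -- is idle and makes no visit.
  · refine (Set.ncard_le_ncard_of_injOn (fun j => if j ≤ i then j else j + 1) ?_ ?_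
      (R.finite_visits ν n)).trans (hk ν n)
    · rintro j ⟨hj, hp, hv⟩
      replace hj : j < R.len - 1 := hj
      rcases lt_trichotomy j i with h | rfl | h
      · simp only [h.le, if_true]
        exact ⟨by omega, by simpa [R', ptr, h.le] using hp, by simpa [R', h] using hv⟩
      · rcases hidle.2 with hf | ⟨c, hf⟩ <;> simp [R', hf] at hv
      · simp only [h.not_ge, if_false]
        exact ⟨by omega, by simpa [R', ptr, h.not_ge] using hp,
          by simpa [R', h.not_gt, h.ne'] using hv⟩
    · intro x _ y _ hxy
      dsimp only at hxy
      split_ifs at hxy <;> omega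

theorem exists_isProper (hA : A.IsStandardised) {k : ℕ} {w : List α} (R : A.Run)
    (hR : R.Accepts w) (hk : R.IsRestricted k) :
    ∃ R' : A.Run, R'.Accepts w ∧ R'.IsRestricted k ∧ R'.IsProper := by
  induction hl : R.len using Nat.strong_induction_on generalizing R with
  | _ n ih =>
    by_cases hp : R.IsProper
    · exact ⟨R, hR, hk, hp⟩
    · simp only [IsProper, not_forall, not_not] at hp
      obtain ⟨i, hi, h₁, h₂⟩ := hp
      obtain ⟨R', hl', hs, hr, hk'⟩ := R.exists_merge hA hi h₁ h₂
      exact ih _ (hl ▸ hl') R' ⟨hs ▸ hR.1, hr.trans hR.2⟩ (hk' k hk) rfl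

/-! ### Existence of the level-1 history -/

theorem exists_isLevelOneArray (R : A.Run) (hR : R.ptr R.len = []) :
    ∃ (s : ℕ) (l m : Fin s → ℕ) (n : Fin s → ℕ+), R.IsLevelOneArray l m n := by
  classical
  -- The times at which the root is left; the increasing enumeration of `S` orders the excursions.
  let S := (Finset.range R.len).filter fun j => R.ptr j = [] ∧ R.ptr (j + 1) ≠ []
  let f := S.orderEmbOfFin rfl
  have hf : ∀ i, f i < R.len ∧ R.ptr (f i) = [] ∧ R.ptr (f i + 1) ≠ [] := fun i => by
    have h : f i ∈ S := S.orderEmbOfFin_mem rfl i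
    simpa [S] using h
  have hn : ∀ i, ∃ n, R.ptr (f i + 1) = [n] := fun i => by
    obtain ⟨h1, h2, h3⟩ := hf i
    obtain ⟨n, ν, h⟩ := List.exists_cons_of_ne_nil h3
    rw [((R.maps _ h1).2.eq_push_or_up_of_root h2 h).1] at h
    exact ⟨n, h⟩
  have hm : ∀ i, ∃ m, f i + 1 ≤ m ∧ m < R.len ∧ R.ptr (m + 1) = [] ∧
      ∀ j, f i + 1 ≤ j → j ≤ m → R.ptr j ≠ [] := fun i => by
    obtain ⟨h1, h2, h3⟩ := hf i
    have h4 : f i + 1 ≠ R.len := fun h => h3 (h ▸ hR)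
    -- Each excursion returns because the run ends at the root; the first return defines `m i`.
    have hex : ∃ j, f i + 1 ≤ j ∧ R.ptr (j + 1) = [] :=
      ⟨R.len - 1, by omega, by rwa [Nat.sub_add_cancel (by omega)]⟩
    have hle : Nat.find hex ≤ R.len - 1 :=
      Nat.find_min' hex ⟨by omega, by rwa [Nat.sub_add_cancel (by omega)]⟩
    refine ⟨Nat.find hex, (Nat.find_spec hex).1, by omega, (Nat.find_spec hex).2, ?_⟩
    intro j hj hjm
    rcases hj.eq_or_lt with rfl | hj
    · exact h3
    · intro hp
      exact Nat.find_min hex (m := j - 1) (by omega)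
        ⟨by omega, by rwa [Nat.sub_add_cancel (by omega)]⟩
  choose n hn using hn
  choose m hm1 hm2 hm3 hm4 using hm
  exact ⟨_, fun i => f i + 1, m, n,
    { strictMono := fun i i' h => Nat.succ_lt_succ (f.strictMono h)
      le := hm1
      pos := fun i => Nat.succ_pos _
      lt_len := hm2
      ptr_before := fun i => (hf i).2.1
      ptr_start := hn
      ptr_between := hm4
      ptr_after := hm3
      complete := fun j hj h1 h2 => by
        have : j ∈ Set.range f := by
          rw [Finset.range_orderEmbOfFin]
          simp [S, hj, h1, h2]
        obtain ⟨i, hi⟩ := this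
        exact ⟨i, by simp [hi]⟩ }⟩

theorem IsLevelOneArray.exists_hasLevelOneHistory {R : A.Run} {s : ℕ} {l m : Fin s → ℕ}
    {n : Fin s → ℕ+} (h : R.IsLevelOneArray l m n) :
    ∃ h : LevelOneHistory Q C s, R.HasLevelOneHistory l m h := by
  have key : ∀ i j, l i ≤ j → j ≤ R.len →
      ∃ c, (R.stack j).tree.label [n i] = some (some c) := fun i j hij hj => by
    have h1 := (h.child_mem_iff hj (n i)).2 ⟨i, hij, rfl⟩
    have h2 := ((R.stack j).tree.label_eq_at_iff [n i]).not.2 (by simp)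
    rcases h3 : (R.stack j).tree.label [n i] with _ | _ | c
    · exact absurd h3 h1
    · exact absurd h3 h2
    · exact ⟨c, rfl⟩
  choose c hc using fun i => key i (l i) le_rfl ((h.le i).trans (h.lt_len i).le)
  choose d hd using fun i => key i (m i) (h.le i) (h.lt_len i).le
  exact ⟨⟨c, d, fun i => R.state (l i), fun i => R.state (m i), n⟩, h, hc, hd, fun _ => rfl,
    fun _ => rfl⟩

end Run

/-! ### Bounding the number of excursions -/

/-- The numbers `n` such that some rule moves the pointer to the `n`-th child. -/
def directions (A : TSA Q C α) : Set ℕ+ :=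
  {n | ∃ τ ∈ A.rules, (∃ c, τ.instr = .push n c) ∨ τ.instr = .up n}

theorem finite_directions (A : TSA Q C α) : A.directions.Finite := by
  refine (A.finite_rules.image fun τ =>
    match τ.instr with
    | .push n _ => n
    | .up n => n
    | _ => 1).subset ?_
  rintro n ⟨τ, hτ, ⟨c, h⟩ | h⟩ <;> exact ⟨τ, hτ, by simp [h]⟩

namespace Run.IsLevelOneArray

variable {R : A.Run} {s : ℕ} {l m : Fin s → ℕ} {n : Fin s → ℕ+}

theorem visitsFromBelow (h : R.IsLevelOneArray l m n) (i : Fin s) :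
    R.VisitsFromBelow [] (n i) (l i - 1) := by
  have h1 := h.pos i
  have h2 := h.le i
  have h3 := h.lt_len i
  refine ⟨by omega, h.ptr_before i, ?_⟩
  refine ((R.maps (l i - 1) (by omega)).2.eq_push_or_up_of_root (h.ptr_before i) (ν := []) ?_).2
  rw [Nat.sub_add_cancel h1]
  exact h.ptr_start i

theorem child_mem_directions (h : R.IsLevelOneArray l m n) (i : Fin s) : n i ∈ A.directions :=
  ⟨_, R.rule_mem _ (h.visitsFromBelow i).1, (h.visitsFromBelow i).2.2⟩

/-- Distinct excursions to one child are distinct visits from below, so each direction accounts for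
at most `k` of them. -/
theorem card_le (h : R.IsLevelOneArray l m n) {k : ℕ} (hk : R.IsRestricted k) :
    s ≤ k * A.finite_directions.toFinset.card := by
  classical
  have := Finset.card_le_mul_card_image_of_maps_to (s := (Finset.univ : Finset (Fin s)))
    (t := A.finite_directions.toFinset) (f := n)
    (fun i _ => by simpa using h.child_mem_directions i) k ?_
  · simpa using this
  · intro x _
    rw [← Set.ncard_coe_finset]
    refine (Set.ncard_le_ncard_of_injOn (fun i => l i - 1) ?_ ?_
      (R.finite_visits [] x)).trans (hk [] x)
    · intro i hi
      obtain rfl : n i = x := by simpa using hi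
      exact h.visitsFromBelow i
    · intro i _ i' _ hii
      have h1 := h.pos i
      have h2 := h.pos i'
      dsimp only at hii
      exact h.strictMono.injective (by omega)

end Run.IsLevelOneArray

/-! ### Pumping at the root -/

namespace Run

theorem length_read_le (R : A.Run) (i j : ℕ) : (R.read i j).length ≤ j - i := by
  rcases le_total i j with h | h
  · induction j, h using Nat.le_induction with
    | base => simp [read_self]
    | succ j hj ih =>
      have : (R.rule j).letter.toList.length ≤ 1 := by cases (R.rule j).letter <;> simp
      rw [read_succ _ hj, List.length_append]
      omega
  · simp [read, List.Ico.eq_nil_of_le h]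

/-- A discrete intermediate value argument: each rule reads at most one letter. -/
theorem exists_length_read_eq (R : A.Run) {a b : ℕ} (hab : a ≤ b) {t : ℕ}
    (ht : t ≤ (R.read a b).length) : ∃ j, a ≤ j ∧ j ≤ b ∧ (R.read a j).length = t := by
  induction b, hab using Nat.le_induction with
  | base => exact ⟨a, le_rfl, le_rfl, by simp [read_self] at ht ⊢; exact ht.symm⟩
  | succ b hb ih =>
    rcases le_or_gt t (R.read a b).length with h | h
    · obtain ⟨j, h1, h2, h3⟩ := ih h
      exact ⟨j, h1, h2.trans (Nat.le_succ b), h3⟩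
    · refine ⟨b + 1, by omega, le_rfl, le_antisymm ?_ ht⟩
      have : (R.rule b).letter.toList.length ≤ 1 := by cases (R.rule b).letter <;> simp
      rw [read_succ _ hb, List.length_append]
      omega

theorem reaches_pump (R : A.Run) {i j : ℕ} (hij : i ≤ j) (hj : j ≤ R.len)
    (hstate : R.state i = R.state j) (hstack : R.stack i = R.stack j) (n : ℕ) :
    A.Reaches (R.state R.len) (R.stack R.len)
      (R.read 0 i ++ (List.replicate n (R.read i j)).flatten ++ R.read j R.len) := by
  refine Reaches.along R ?_ hj le_rfl
  induction n with
  | zero => simpa [← hstate, ← hstack] using R.reaches (hij.trans hj)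
  | succ n ih =>
    rw [← hstate, ← hstack] at ih
    simpa [List.replicate_succ'] using ih.along R hij hj

/-- Pigeonhole on the `|Q| + 1` times at which `0, μ, …, μ * |Q|` letters of the phase have been
read: two share their state, and the tree stack is constant. -/
theorem isPumpable_of_root [Finite Q] (R : A.Run) (hf : R.state R.len ∈ A.final) {a b : ℕ}
    (hab : a ≤ b) (hb : b ≤ R.len) (h : ∀ j, a ≤ j → j ≤ b → R.ptr j = []) {μ : ℕ} (hμ : 1 ≤ μ)
    (hl : μ * Nat.card Q ≤ (R.read a b).length) :
    IsPumpable A.language μ (μ * Nat.card Q) (R.read 0 R.len) := by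
  have := Fintype.ofFinite Q
  have hpos : ∀ t : Fin (Nat.card Q + 1), ∃ j, a ≤ j ∧ j ≤ b ∧ (R.read a j).length = μ * t :=
    fun t => R.exists_length_read_eq hab ((Nat.mul_le_mul_left μ (Nat.lt_succ_iff.1 t.2)).trans hl)
  choose j haj hjb hlen using hpos
  obtain ⟨t, t', hne, heq⟩ := Fintype.exists_ne_map_eq_of_card_lt (fun t => R.state (j t))
    (by simp)
  wlog hlt : t < t' generalizing t t'
  · exact this t' t hne.symm heq.symm (lt_of_le_of_ne (not_lt.1 hlt) hne.symm)
  have hmul : μ * t + μ ≤ μ * t' := by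
    rw [← Nat.mul_succ]
    exact Nat.mul_le_mul_left μ hlt
  have hjj : j t ≤ j t' := by
    by_contra hc
    have := congrArg List.length (R.read_append (haj t') (not_le.1 hc).le)
    rw [List.length_append, hlen, hlen] at this
    omega
  have hy := congrArg List.length (R.read_append (haj t) hjj)
  rw [List.length_append, hlen, hlen] at hy
  have hcard : μ * t' ≤ μ * Nat.card Q := Nat.mul_le_mul_left μ (Nat.lt_succ_iff.1 t'.2)
  have hstack : R.stack (j t) = R.stack (j t') := by
    rw [R.stack_eq_of_root hb h _ (haj t) (hjb t), R.stack_eq_of_root hb h _ (haj t') (hjb t')]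
  have hj' : j t' ≤ R.len := (hjb t').trans hb
  refine ⟨⟨R, hf, rfl⟩, R.read 0 (j t), R.read (j t) (j t'), R.read (j t') R.len, ?_, by omega,
    by omega, fun n => mem_language_iff.2 ⟨_, hf, _, R.reaches_pump hjj hj' heq hstack n⟩⟩
  rw [R.read_append (Nat.zero_le _) hjj, R.read_append (Nat.zero_le _) hj']

/-- An outer factor is a root phase with at most two further letters, read by the `down` before it
and the upward move after it. -/
theorem IsLevelOneArray.length_outer_le [Finite Q] {R : A.Run} {s : ℕ} {l m : Fin s → ℕ}
    {n : Fin s → ℕ+} (h : R.IsLevelOneArray l m n) (hf : R.state R.len ∈ A.final) {μ : ℕ}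
    (hμ : 1 ≤ μ) (hp : ¬ IsPumpable A.language μ (μ * Nat.card Q) (R.read 0 R.len))
    (e : Fin (s + 1)) : (R.outer l m e).length ≤ μ * Nat.card Q + 2 := by
  have h0 := h.rootStart_le_rootEnd e
  have h1 : segStart m e ≤ rootStart m e ∧ rootStart m e ≤ segStart m e + 1 := by
    cases e using Fin.cases <;> simp
  have h2 : R.rootEnd l e ≤ R.segEnd l e ∧ R.segEnd l e ≤ R.rootEnd l e + 1 := by
    cases e using Fin.lastCases with
    | last => simp
    | cast i => simp; omega
  have h3 := R.length_read_le (segStart m e) (rootStart m e)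
  have h4 := R.length_read_le (R.rootEnd l e) (R.segEnd l e)
  have h5 : (R.read (rootStart m e) (R.rootEnd l e)).length < μ * Nat.card Q := by
    by_contra hc
    exact hp (R.isPumpable_of_root hf h0 (h.rootEnd_le_len e) (h.ptr_root e) hμ (not_lt.1 hc))
  rw [outer, ← R.read_append h1.1 (h0.trans h2.1), ← R.read_append h0 h2.1, List.length_append,
    List.length_append]
  omega

end Run

/-! ### Level-1 histories of bounded size -/

/-- The data of a nonempty level-1 history with at most `K` columns and with children in `D`. -/
abbrev BoundedHistory (Q C : Type*) (D : Set ℕ+) (K : ℕ) : Type _ :=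
  Σ s : Fin K, Fin (s + 1) → C × C × Q × Q × D

/-- The level-1 history with the given data. -/
def BoundedHistory.toHistory {D : Set ℕ+} {K : ℕ} (x : BoundedHistory Q C D K) :
    LevelOneHistory Q C (x.1 + 1) where
  cUp i := (x.2 i).1
  cDown i := (x.2 i).2.1
  qUp i := (x.2 i).2.2.1
  qDown i := (x.2 i).2.2.2.1
  child i := (x.2 i).2.2.2.2

/-- Gives `M ≥ 1`. Any entries will do, since an up-set may be empty. -/
theorem HasPush.nonempty_boundedHistory (h : A.HasPush) {K : ℕ} (hK : 1 ≤ K) :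
    Nonempty (BoundedHistory Q C A.directions K) := by
  obtain ⟨τ, hτ, n, c, h⟩ := h
  exact ⟨⟨⟨0, hK⟩, fun _ => ⟨c, c, τ.source, τ.source, n, τ, hτ, .inl ⟨c, h⟩⟩⟩⟩

theorem exists_length_bound_of_finite {ι : Type*} [Finite ι] {s : ι → ℕ}
    (U : (i : ι) → Set (Fin (s i) → List α)) :
    ∃ B, ∀ i, (U i).Finite → ∀ u ∈ U i, ∑ j, (u j).length ≤ B := by
  have : ∀ i, ∃ b, (U i).Finite → ∀ u ∈ U i, ∑ j, (u j).length ≤ b := fun i => by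
    by_cases h : (U i).Finite
    · obtain ⟨b, hb⟩ := (h.image fun u => ∑ j, (u j).length).bddAbove
      exact ⟨b, fun _ u hu => hb ⟨u, hu, rfl⟩⟩
    · exact ⟨0, fun h' => absurd h' h⟩
  choose b hb using this
  obtain ⟨B, hB⟩ := Finite.exists_le b
  exact ⟨B, fun i hi u hu => (hb i hi u hu).trans (hB i)⟩

end TSA

/-! ### Marked words and the final dichotomy -/

theorem MarkedWord.numMarked_le {α : Type*} (w : MarkedWord α) : w.numMarked ≤ w.forget.length :=
  List.countP_le_length.trans (by simp [MarkedWord.forget])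

theorem IsPumpable.mono {α : Type*} {L : Language α} {a b b' : ℕ} {w : List α} (hb : b ≤ b')
    (h : IsPumpable L a b w) : IsPumpable L a b' w := by
  obtain ⟨hw, x, y, z, h1, h2, h3, h4⟩ := h
  exact ⟨hw, x, y, z, h1, h2, h3.trans hb, h4⟩

theorem TSA.IsStandardAcceptor.exists_levelOneHistory {Q C α : Type*} {A : TSA Q C α} {k : ℕ}
    {L : Language α} (hA : A.IsStandardAcceptor k L) {x : List α} (hx : x ∈ L) :
    ∃ (R : A.Run) (s : ℕ) (l m : Fin s → ℕ) (h : LevelOneHistory Q C s), R.Accepts x ∧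
      R.IsRestricted k ∧ R.IsProper ∧ R.HasLevelOneHistory l m h := by
  rw [← hA.language_eq] at hx
  obtain ⟨R, hR, hk⟩ := hA.restricted x hx
  obtain ⟨R, hR, hk, hp⟩ := R.exists_isProper hA.standardised hR hk
  obtain ⟨s, l, m, n, ha⟩ := R.exists_isLevelOneArray (hA.returnsToRoot R hR.1)
  obtain ⟨h, hh⟩ := ha.exists_hasLevelOneHistory
  exact ⟨R, s, l, m, h, hR, hk, hp, hh⟩

/-- Each word with many marked letters is pumpable, or it has a factorisation that is switchable
for one of the infinite level-1 up-sets of bounded size, with few marked letters outside. -/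
theorem TSA.IsStandardAcceptor.exists_bound {Q C α : Type*} [Finite Q] [Finite C]
    {A : TSA Q C α} {k K : ℕ} {L : Language α} (hA : A.IsStandardAcceptor k L)
    (hK : k * A.finite_directions.toFinset.card ≤ K) {μ : ℕ} (hμ : 1 ≤ μ) :
    ∃ N : ℕ, μ ≤ N ∧ ∀ x : MarkedWord α, x.forget ∈ L → N ≤ x.numMarked →
      IsPumpable L μ N x.forget ∨
      ∃ b : BoundedHistory Q C A.directions K, (A.levelOneUpSet b.toHistory).Infinite ∧
        ∃ (w : Fin (b.1 + 1 + 1) → MarkedWord α) (u : Fin (b.1 + 1) → MarkedWord α),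
          x = interleave w u ∧
          IsSwitchableFactorisation L (A.levelOneUpSet b.toHistory) x.forget
            (fun j => (w j).forget) (fun j => (u j).forget) ∧
          ∑ j, (w j).numMarked ≤ N := by
  have := A.finite_directions.to_subtype
  obtain ⟨B, hB⟩ := exists_length_bound_of_finite
    fun b : BoundedHistory Q C A.directions K => A.levelOneUpSet b.toHistory
  set c := μ * Nat.card Q + 2 with hc
  -- `(K + 1) * c` bounds the at most `K + 1` outer factors together and `B` the tuples in finite
  -- up-sets; `μ` ensures `μ ≤ N`, and the rest makes `N` exceed their sum.
  refine ⟨(K + 1) * c + B + μ + 1, by omega, fun x hx hN => or_iff_not_imp_left.2 fun hp => ?_⟩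
  obtain ⟨R, s, l, m, h, hR, hk, hprop, hh⟩ := hA.exists_levelOneHistory hx
  obtain ⟨hf, hread⟩ := hR
  have hs := (hh.isArray.card_le hk).trans hK
  have hsw := hh.isSwitchableFactorisation hf hprop
  have hcK : c ≤ (K + 1) * c := Nat.le_mul_of_pos_left c (Nat.succ_pos K)
  have hlen : ∀ e, (R.outer l m e).length ≤ c := by
    refine hh.isArray.length_outer_le hf hμ fun h => hp ?_
    rw [hread, hA.language_eq] at h
    exact h.mono (by omega)
  have hsum : ∑ e, (R.outer l m e).length ≤ (K + 1) * c := by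
    refine (Finset.sum_le_card_nsmul _ _ c fun e _ => hlen e).trans ?_
    simpa using Nat.mul_le_mul_right c (Nat.succ_le_succ hs)
  have htotal := congrArg List.length hsw.eq
  rw [length_interleave, hread] at htotal
  have hmarked := x.numMarked_le
  rw [hread, hA.language_eq] at hsw
  cases s with
  | zero =>
    -- Without excursions the whole word is a single outer factor, too short for `N` marked letters.
    simp only [Finset.univ_eq_empty, Finset.sum_empty] at htotal
    omega
  | succ s =>
    let b : BoundedHistory Q C A.directions K :=
      ⟨⟨s, hs⟩, fun i => ⟨h.cUp i, h.cDown i, h.qUp i, h.qDown i, h.child i,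
        hh.isArray.child_mem_directions i⟩⟩
    refine ⟨b, fun hfin => ?_, ?_⟩
    -- If the up-set were finite, the whole word would have at most `(K + 1) * c + B < N` letters.
    · have := hB b hfin _ hsw.factor_mem
      change ∑ j : Fin (s + 1), _ ≤ B at this
      omega
    · obtain ⟨w, u, hx, hw, hu⟩ := exists_interleave_of_map_eq Prod.fst hsw.eq
      have hw' : (fun j => MarkedWord.forget (w j)) = R.outer l m := funext hw
      have hu' : (fun j => MarkedWord.forget (u j)) = fun i => R.read (l i) (m i) := funext hu
      refine ⟨w, u, hx, ?_, ?_⟩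
      · rw [hw', hu']
        exact hsw
      · refine (Finset.sum_le_sum fun j _ => MarkedWord.numMarked_le (w j)).trans ?_
        have : ∑ j, (MarkedWord.forget (w j)).length = ∑ e, (R.outer l m e).length :=
          Finset.sum_congr rfl fun j _ => congrArg List.length (hw j)
        change ∑ j : Fin (s + 1 + 1), _ ≤ _
        omega

theorem proposition5p8 {α : Type*} [Finite α] (k : ℕ) (hk : 1 ≤ k) (L : Language α)
    (hinf : Set.Infinite (L : Set (List α))) (hL : IsMCF k L) :
    (∃ (Q C : Type) (_ : Finite Q) (_ : Finite C) (A : TSA Q C α), A.IsStandardAcceptor k L) ∧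
    ∀ (Q C : Type) (_ : Finite Q) (_ : Finite C) (A : TSA Q C α), A.IsStandardAcceptor k L →
      ∀ μ : ℕ, 1 ≤ μ →
        ∃ (K M : ℕ) (m : Fin M → ℕ) (U : (i : Fin M) → Set (Fin (m i) → List α)),
          k ≤ K ∧ 1 ≤ M ∧ (∀ i, 1 ≤ m i ∧ m i ≤ K) ∧
          (∀ i, ∃ h : TSA.LevelOneHistory Q C (m i), U i = A.levelOneUpSet h) ∧
          (∀ i, ∀ u ∈ U i, ∃ (x : List α) (w : Fin (m i + 1) → List α),
            IsSwitchableFactorisation L (U i) x w u) ∧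
          ∃ N : ℕ, μ ≤ N ∧ ∀ x : MarkedWord α, x.forget ∈ L → N ≤ x.numMarked →
            IsPumpable L μ N x.forget ∨
            ∃ i, (U i).Infinite ∧
              ∃ (w : Fin (m i + 1) → MarkedWord α) (u : Fin (m i) → MarkedWord α),
                x = interleave w u ∧
                IsSwitchableFactorisation L (U i) x.forget
                  (fun j => (w j).forget) (fun j => (u j).forget) ∧
                ∑ j, (w j).numMarked ≤ N := by
  refine ⟨hL.exists_isStandardAcceptor, fun Q C _ _ A hA μ hμ => ?_⟩
  -- The summand `k` secures both `k ≤ K` and `1 ≤ K`.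
  let K := k * A.finite_directions.toFinset.card + k
  obtain ⟨N, hN, hbound⟩ := hA.exists_bound (K := K) (Nat.le_add_right _ _) hμ
  have := A.finite_directions.to_subtype
  have := hA.hasPush.nonempty_boundedHistory (show 1 ≤ K by omega)
  let e := Finite.equivFin (TSA.BoundedHistory Q C A.directions K)
  refine ⟨K, Nat.card (TSA.BoundedHistory Q C A.directions K), fun i => (e.symm i).1 + 1,
    fun i => A.levelOneUpSet (e.symm i).toHistory, Nat.le_add_left _ _, Nat.card_pos,
    fun i => ⟨Nat.le_add_left _ _, (e.symm i).1.2⟩, fun i => ⟨_, rfl⟩, ?_, N, hN, ?_⟩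
  -- The word read by a run that witnesses `u` has the required factorisation.
  · rintro i u ⟨R, hf, hp, l, m, hR, hu⟩
    obtain rfl : u = fun i => R.read (l i) (m i) := funext hu
    exact ⟨_, _, hA.language_eq ▸ hR.isSwitchableFactorisation hf hp⟩
  · intro x hx hNx
    refine (hbound x hx hNx).imp_right fun ⟨b, hb⟩ => ?_
    obtain ⟨i, rfl⟩ := e.symm.surjective b
    exact ⟨i, hb⟩
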